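/- Let $X$ and $X_0$ be $C^\infty$ vector fields on $\mathbb R^N$ with $X_0(0)=0$ such that $X_1=X-X_0$ vanishes to infinite order at $0$ (all its partial derivatives, of every order $\ge 0$, vanish at $0$). Suppose that there is a compact set outside which both $X$ and $X_0$ are equal to their common linearization at $0$, i.e. $X(x)=X_0(x)=DX(0)x$, and that $DX(0)$ is hyperbolic: every complex eigenvalue of $DX(0)$ has non-zero real part. Let $U(t)$, $U_0(t)$, $t\in\mathbb R$, be the (globally defined) flows of $X$ and $X_0$. Let $E\subset\mathbb R^N$ be a linear subspace invariant under $X_0$ (i.e. $X_0(x)\in E$ for all $x\in E$) such that $\lim_{t\to+\infty}U_0(t)x=0$ for all $x\in E$. Then the maps $U(-t)U_0(t)$ are $C^\infty$ on $\mathbb R^N$, and for every $j=0,1,2,\dots$ and every $x\in E$ the limit $$\lim_{t\to+\infty}D^j\bigl(U(-t)U_0(t)\bigr)(x)$$ exists and is continuous in $x\in E$; here $D^j$ denotes the full $j$-th derivative in the ambient space $\mathbb R^N$, not only along $E$. Moreover the map $$W_-x=\lim_{t\to+\infty}U(-t)U_0(t)x,\qquad x\in E,$$ has a $C^\infty$ extension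 $G:\mathbb R^N\to\mathbb R^N$ which is the identity to infinite order at $0$ (that is, $G-\mathrm{Id}$ vanishes to infinite order at $0$) and such that $(G^{-1})_*X=X_0$ to infinite order along $E$ in a neighbourhood of $0$: there is an open neighbourhood $O$ of $0$ which $G$ maps diffeomorphically onto an open set, and all derivatives, of every order $\ge 0$, of the vector field $(G|_O^{-1})_*X-X_0$ on $O$ vanish at every point of $E\cap O$. -/

import Mathlib

open scoped ContDiff Topology
open Filter

namespace Nelson

/-- `U` is the global flow of the vector field `X` on `V`: for each initial point `x` the curve
`t ↦ U t x` is defined for all real `t`, starts at `x` and is an integral curve of `X`. -/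
def IsFlow {V : Type*} [NormedAddCommGroup V] [NormedSpace ℝ V]
    (X : V → V) (U : ℝ → V → V) : Prop :=
  ∀ x : V, U 0 x = x ∧ IsIntegralCurve (fun t => U t x) (fun _ => X)

open Classical in
/-- The flow of `X`: `flow X t x` is the value at time `t` of the integral curve of `X` that starts
at `x` (unique when `X` is of class `C¹`). If there is no such curve on all of `ℝ`, the default
value is `x`. -/
noncomputable def flow {V : Type*} [NormedAddCommGroup V] [NormedSpace ℝ V]
    (X : V → V) (t : ℝ) (x : V) : V :=
  if h : ∃ γ : ℝ → V, γ 0 = x ∧ IsIntegralCurve γ (fun _ => X) then h.choose t else x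

/-- All derivatives of `f` at `x`, of order `0, 1, 2, …`, are zero
(used for `f` smooth near `x`). -/
def VanishesToInfiniteOrderAt {V W : Type*} [NormedAddCommGroup V] [NormedSpace ℝ V]
    [NormedAddCommGroup W] [NormedSpace ℝ W] (f : V → W) (x : V) : Prop :=
  ∀ j : ℕ, iteratedFDeriv ℝ j f x = 0

/-- No eigenvalue of the complexification of `A` lies on the imaginary axis (`0` included). -/
def IsHyperbolic {V : Type*} [NormedAddCommGroup V] [NormedSpace ℝ V] (A : V →L[ℝ] V) : Prop :=
  ∀ z : ℂ, Module.End.HasEigenvalue (A.toLinearMap.baseChange ℂ) z → z.re ≠ 0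

/-- The push-forward `Φ_* X` of the vector field `X` under `Φ : Φ.source → Φ.target`,
`(Φ_* X)(y) = DΦ(Φ⁻¹ y) X(Φ⁻¹ y)`; meaningful for `y ∈ Φ.target`. -/
noncomputable def pushforward {V : Type*} [NormedAddCommGroup V] [NormedSpace ℝ V]
    (Φ : OpenPartialHomeomorph V V) (X : V → V) (y : V) : V :=
  fderiv ℝ Φ (Φ.symm y) (X (Φ.symm y))

end Nelson

/-! Write W_t = U(-t)U₀(t) (`wave`). The group laws give W_{n+s} - W_n = (U(-n)∘W_s - U(-n))∘U₀(n).
Three facts make this increment small at points of E. Both fields are linear outside a compact set,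
so the derivatives of U(-n) and U₀(n) up to a fixed positive order grow at most exponentially in n
(`BddDeriv.iterate_bound`). Since X - X₀ is flat at 0, W_s - Id is O(‖y‖^m) with all derivatives,
for every m and uniformly for 0 ≤ s ≤ 1 (`IsFlow.exists_iteratedFDeriv_wave_sub_bound`). Orbits of
U₀ in E decay exponentially, uniformly on bounded sets (`IsFlow.exists_exponential_decay`). As m is
free, a high power of the decay beats the fixed exponential growth, and the increments with all
ambient derivatives are smaller than any given exponential (`WaveData.exists_increment_bound`).

The same estimate at time n holds within distance 2/bⁿ of E, measured by a projection, for a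
suitable b (`exists_decay_near`). Hence the limit extends explicitly as G = Id + ∑ χ_n (W_{n+1} -
W_n), where χ_n is a cutoff to that neighbourhood. A derivative of order k of χ_n costs only b^{kn},
so the series converges with all derivatives on bounded sets. Every χ_n is 1 near a given point of
E, so there the series telescopes, also after differentiation, and the derivatives of W_n converge
to those of G.

Finally X∘W_n - DW_n·X₀ = (DU(-n)·(X - X₀))∘U₀(n) tends to 0 on E with all derivatives for the same
reason (`WaveData.exists_defect_bound`). In the limit X∘G - DG·X₀ is flat along E. As DG(0) = Id,
the inverse function theorem turns this into the statement on the push-forward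
(`exists_local_diffeo`). -/

namespace Nelson

open Set Metric MeasureTheory NNReal

/-! ### Global flows of Lipschitz vector fields. -/

section Flow

variable {V : Type*} [NormedAddCommGroup V] [NormedSpace ℝ V]

/-- Global integral curves of a Lipschitz field with the same value at some time coincide. -/
theorem integralCurve_unique {X : V → V} {K : ℝ≥0} (hK : LipschitzWith K X) {γ δ : ℝ → V}
    (hγ : IsIntegralCurve γ (fun _ => X)) (hδ : IsIntegralCurve δ (fun _ => X)) {t₀ : ℝ}
    (h : γ t₀ = δ t₀) : γ = δ :=
  ODE_solution_unique_univ (v := fun _ => X) (s := fun _ => univ) (fun _ => hK.lipschitzOnWith)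
    (fun t => ⟨hγ t, mem_univ _⟩) (fun t => ⟨hδ t, mem_univ _⟩) h

/-- On the ball of radius a = ‖X x‖ + 1 the speed is at most ‖X x‖ + K a ≤ (1 + K) a, so the
existence time 1 / (1 + K) does not depend on x. This uniformity is what yields global curves. -/
theorem exists_local_integralCurve [CompleteSpace V] {X : V → V} {K : ℝ≥0}
    (hK : LipschitzWith K X) (x : V) :
    ∃ γ : ℝ → V, γ 0 = x ∧
      ∀ t ∈ Ioo (-(1 / (1 + K : ℝ))) (1 / (1 + K : ℝ)), HasDerivAt γ (X (γ t)) t := by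
  have hK1 : (0 : ℝ) < 1 / (1 + K : ℝ) := by positivity
  set a : ℝ≥0 := ‖X x‖₊ + 1 with ha
  set L : ℝ≥0 := ‖X x‖₊ + K * a with hL
  have hpl : IsPicardLindelof (fun _ => X) (tmin := -(1 / (1 + K : ℝ))) (tmax := 1 / (1 + K : ℝ))
      ⟨0, by constructor <;> linarith⟩ x a 0 L K := by
    refine IsPicardLindelof.of_time_independent (fun y hy => ?_) hK.lipschitzOnWith ?_
    · have h1 : ‖X y - X x‖ ≤ K * a := by
        rw [← dist_eq_norm]
        exact (hK.dist_le_mul _ _).trans (by gcongr; exact hy)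
      have h2 : ‖X y‖ ≤ ‖X x‖ + ‖X y - X x‖ := by
        simpa using norm_add_le (X x) (X y - X x)
      simp only [hL, NNReal.coe_add, NNReal.coe_mul, coe_nnnorm]
      linarith
    · simp only [sub_zero, zero_sub, neg_neg, max_self, NNReal.coe_zero]
      rw [mul_one_div, div_le_iff₀ (by positivity)]
      simp only [hL, ha, NNReal.coe_add, NNReal.coe_mul, coe_nnnorm, NNReal.coe_one]
      nlinarith [norm_nonneg (X x), K.coe_nonneg]
  obtain ⟨γ, h0, h⟩ := hpl.exists_eq_forall_mem_Icc_hasDerivWithinAt₀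
  exact ⟨γ, h0, fun t ht => (h t (Ioo_subset_Icc_self ht)).hasDerivAt (Icc_mem_nhds ht.1 ht.2)⟩

theorem exists_integralCurve [CompleteSpace V] {X : V → V} {K : ℝ≥0} (hX : ContDiff ℝ 1 X)
    (hK : LipschitzWith K X) (x : V) :
    ∃ γ : ℝ → V, γ 0 = x ∧ IsIntegralCurve γ (fun _ => X) := by
  obtain ⟨γ, h0, h⟩ := exists_isMIntegralCurve_of_isMIntegralCurveOn (I := modelWithCornersSelf ℝ V)
    (M := V) (v := X) (contMDiff_vectorSpace_iff_contDiff.2 hX)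
    (ε := 1 / (1 + K : ℝ)) (by positivity) (fun x => by
      obtain ⟨γ, h0, h⟩ := exists_local_integralCurve hK x
      exact ⟨γ, h0, fun t ht => ((h t ht).hasFDerivAt.hasMFDerivAt).hasMFDerivWithinAt⟩) x
  exact ⟨γ, h0, fun t => (h t).hasFDerivAt⟩

theorem isFlow_flow [CompleteSpace V] {X : V → V} {K : ℝ≥0} (hX : ContDiff ℝ 1 X)
    (hK : LipschitzWith K X) : IsFlow X (flow X) := by
  intro x
  have h := exists_integralCurve hX hK x
  have : (fun t => flow X t x) = h.choose := by
    ext t; simp only [flow, dif_pos h]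
  exact ⟨(congrFun this 0).trans h.choose_spec.1, this ▸ h.choose_spec.2⟩

namespace IsFlow

variable {X : V → V} {K : ℝ≥0} {U : ℝ → V → V}

theorem hasDerivAt (hU : IsFlow X U) (x : V) (t : ℝ) :
    HasDerivAt (fun t => U t x) (X (U t x)) t := (hU x).2 t

theorem continuous_time (hU : IsFlow X U) (x : V) : Continuous fun t => U t x :=
  continuous_iff_continuousAt.2 fun t => (hU.hasDerivAt x t).continuousAt

theorem eq_of_integralCurve (hU : IsFlow X U) (hK : LipschitzWith K X) {γ : ℝ → V}
    (hγ : IsIntegralCurve γ (fun _ => X)) (t : ℝ) : U t (γ 0) = γ t :=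
  congrFun (integralCurve_unique hK (hU (γ 0)).2 hγ (t₀ := 0) (hU _).1) t

theorem add (hU : IsFlow X U) (hK : LipschitzWith K X) (s t : ℝ) (x : V) :
    U (s + t) x = U s (U t x) := by
  have h : IsIntegralCurve (fun s => U (s + t) x) (fun _ => X) := fun s =>
    (hU.hasDerivAt x (s + t)).comp_add_const s t
  have := hU.eq_of_integralCurve hK h s
  simpa using this.symm

theorem neg_cancel (hU : IsFlow X U) (hK : LipschitzWith K X) (t : ℝ) (x : V) :
    U (-t) (U t x) = x := by
  rw [← hU.add hK, neg_add_cancel, (hU x).1]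

theorem iterate (hU : IsFlow X U) (hK : LipschitzWith K X) (s : ℝ) (n : ℕ) :
    U (n * s) = (U s)^[n] := by
  induction n with
  | zero => ext x; simp [(hU x).1]
  | succ n ih =>
    ext x
    rw [Function.iterate_succ_apply', ← ih, ← hU.add hK]
    congr 1; push_cast; ring

theorem fixed (hU : IsFlow X U) (hK : LipschitzWith K X) {x : V} (hx : X x = 0) (t : ℝ) :
    U t x = x :=
  hU.eq_of_integralCurve hK (γ := fun _ => x) (isIntegralCurve_const fun _ => hx) t

/-- The reversed flow is the flow of the opposite field. -/
theorem neg (hU : IsFlow X U) : IsFlow (fun x => -X x) (fun t => U (-t)) := by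
  refine fun x => ⟨by simpa using (hU x).1, fun t => ?_⟩
  simpa [Function.comp_def] using (hU.hasDerivAt x (-t)).scomp t (hasDerivAt_neg t)

/-- A curve that almost solves the equation on `[0, S]` stays close to the trajectory. -/
theorem dist_le_of_approx (hU : IsFlow X U) (hK : LipschitzWith K X) {S : ℝ} {γ γ' : ℝ → V}
    (hγ : ∀ t, HasDerivAt γ (γ' t) t) {ε : ℝ} (h : ∀ t ∈ Icc 0 S, ‖γ' t - X (γ t)‖ ≤ ε) {t : ℝ}
    (ht : t ∈ Icc 0 S) : ‖γ t - U t (γ 0)‖ ≤ ε * gronwallBound 0 K 1 t := by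
  have := dist_le_of_approx_trajectories_ODE (v := fun _ => X) (K := K) (f := γ) (f' := γ')
    (g := fun t => U t (γ 0)) (g' := fun t => X (U t (γ 0))) (a := 0) (b := S) (εf := ε) (εg := 0)
    (δ := 0) (fun _ => hK) (fun t _ => (hγ t).continuousAt.continuousWithinAt)
    (fun t _ => (hγ t).hasDerivWithinAt)
    (fun t ht => by rw [dist_eq_norm]; exact h t ⟨ht.1, ht.2.le⟩)
    (fun t _ => (hU.hasDerivAt _ t).continuousAt.continuousWithinAt)
    (fun t _ => (hU.hasDerivAt _ t).hasDerivWithinAt) (fun t _ => by simp)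
    (by simp [(hU (γ 0)).1]) t ht
  rw [dist_eq_norm] at this
  convert this using 1
  by_cases hk : (K : ℝ) = 0
  · simp [hk, gronwallBound_K0]
  · simp [gronwallBound_of_K_ne_0 hk]; ring

theorem lipschitz_of_nonneg (hU : IsFlow X U) (hK : LipschitzWith K X) {t : ℝ} (ht : 0 ≤ t) :
    LipschitzWith (Real.toNNReal (Real.exp (K * t))) (U t) := by
  refine LipschitzWith.of_dist_le_mul fun x y => ?_
  have := dist_le_of_trajectories_ODE (v := fun _ => X) (K := K) (f := fun t => U t x)
    (g := fun t => U t y) (a := 0) (b := t)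
    (δ := dist x y) (fun _ => hK) (fun t _ => (hU.hasDerivAt _ t).continuousAt.continuousWithinAt)
    (fun t _ => (hU.hasDerivAt _ t).hasDerivWithinAt)
    (fun t _ => (hU.hasDerivAt _ t).continuousAt.continuousWithinAt)
    (fun t _ => (hU.hasDerivAt _ t).hasDerivWithinAt)
    (by simp [(hU x).1, (hU y).1]) t ⟨ht, le_rfl⟩
  rw [Real.coe_toNNReal _ (Real.exp_pos _).le]
  simpa [mul_comm] using this

theorem lipschitz (hU : IsFlow X U) (hK : LipschitzWith K X) (t : ℝ) :
    LipschitzWith (Real.toNNReal (Real.exp (K * |t|))) (U t) := by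
  rcases le_total 0 t with ht | ht
  · rw [abs_of_nonneg ht]; exact hU.lipschitz_of_nonneg hK ht
  · have h2 : LipschitzWith K (fun x => -X x) := hK.neg
    have := hU.neg.lipschitz_of_nonneg h2 (t := -t) (by linarith)
    rw [abs_of_nonpos ht]; simpa using this

end IsFlow

end Flow

end Nelson

namespace Nelson

open Set Metric MeasureTheory NNReal

/-! ### Smooth maps with bounded derivatives of positive order. -/

section BddDeriv

variable {V F H : Type*} [NormedAddCommGroup V] [NormedSpace ℝ V] [NormedAddCommGroup F]
  [NormedSpace ℝ F] [NormedAddCommGroup H] [NormedSpace ℝ H]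

/-- `f` is smooth and each of its derivatives of positive order is bounded. -/
def BddDeriv (f : V → F) : Prop :=
  ContDiff ℝ ∞ f ∧ ∀ k : ℕ, ∃ C : ℝ, ∀ x, ‖iteratedFDeriv ℝ (k + 1) f x‖ ≤ C

theorem BddDeriv.fderiv {f : V → F} (hf : BddDeriv f) : BddDeriv (fderiv ℝ f) :=
  ⟨hf.1.fderiv_right (by simp), fun k => by
    obtain ⟨C, hC⟩ := hf.2 (k + 1)
    exact ⟨C, fun x => by rw [norm_iteratedFDeriv_fderiv]; exact hC x⟩⟩

theorem BddDeriv.norm_fderiv_le {f : V → F} (hf : BddDeriv f) :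
    ∃ C : ℝ≥0, ∀ x, ‖_root_.fderiv ℝ f x‖ ≤ C := by
  obtain ⟨C, hC⟩ := hf.2 0
  refine ⟨C.toNNReal, fun x => ?_⟩
  have := hC x
  rw [zero_add, norm_iteratedFDeriv_one] at this
  exact this.trans (Real.le_coe_toNNReal C)

theorem BddDeriv.lipschitz {f : V → F} (hf : BddDeriv f) : ∃ C, LipschitzWith C f := by
  obtain ⟨C, hC⟩ := hf.norm_fderiv_le
  exact ⟨C, lipschitzWith_of_nnnorm_fderiv_le (hf.1.differentiable (by simp)) fun x => hC x⟩

theorem BddDeriv.taylor {f : V → F} (hf : BddDeriv f) :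
    ∃ C : ℝ, 0 ≤ C ∧ ∀ x h, ‖f (x + h) - f x - _root_.fderiv ℝ f x h‖ ≤ C * ‖h‖ ^ 2 := by
  obtain ⟨C, hC⟩ := hf.fderiv.lipschitz
  refine ⟨C, C.2, fun x h => ?_⟩
  have := (convex_segment x (x + h)).norm_image_sub_le_of_norm_fderiv_le' (𝕜 := ℝ) (f := f)
    (C := C * ‖h‖) (φ := _root_.fderiv ℝ f x) (x := x) (y := x + h)
    (fun y _ => (hf.1.differentiable (by simp)) y) (fun y hy => by
      rw [← dist_eq_norm]
      refine (hC.dist_le_mul _ _).trans ?_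
      gcongr
      rw [dist_eq_norm]
      simpa using norm_sub_le_of_mem_segment hy)
    (left_mem_segment ..) (right_mem_segment ..)
  simpa [pow_two, mul_assoc] using this

theorem ContinuousLinearMap.norm_iteratedFDeriv_add_two (A : V →L[ℝ] F) (k : ℕ) (x : V) :
    iteratedFDeriv ℝ (k + 2) A x = 0 := by
  rw [← norm_eq_zero, ← norm_iteratedFDeriv_fderiv,
    show fderiv ℝ A = fun _ => A from funext fun _ => A.fderiv, iteratedFDeriv_succ_const]
  simp

theorem bddDeriv_clm (A : V →L[ℝ] F) : BddDeriv A :=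
  ⟨A.contDiff, fun k => by
    cases k with
    | zero => exact ⟨‖A‖, fun x => by rw [zero_add, norm_iteratedFDeriv_one, A.fderiv]⟩
    | succ k => exact ⟨0, fun x => by rw [ContinuousLinearMap.norm_iteratedFDeriv_add_two]; simp⟩⟩

theorem BddDeriv.add {f g : V → F} (hf : BddDeriv f) (hg : BddDeriv g) :
    BddDeriv (fun x => f x + g x) :=
  ⟨hf.1.add hg.1, fun k => by
    obtain ⟨C, hC⟩ := hf.2 k
    obtain ⟨D, hD⟩ := hg.2 k
    refine ⟨C + D, fun x => ?_⟩
    rw [fun_iteratedFDeriv_add_apply (hf.1.contDiffAt.of_le (mod_cast le_top))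
      (hg.1.contDiffAt.of_le (mod_cast le_top))]
    exact (norm_add_le _ _).trans (add_le_add (hC x) (hD x))⟩

theorem bddDeriv_of_hasCompactSupport {f : V → F} (hf : ContDiff ℝ ∞ f)
    (h : HasCompactSupport f) : BddDeriv f :=
  ⟨hf, fun k => by
    obtain ⟨C, hC⟩ := (h.iteratedFDeriv (𝕜 := ℝ) (k + 1)).exists_bound_of_continuous
      (hf.continuous_iteratedFDeriv (m := k + 1) (mod_cast le_top))
    exact ⟨C, hC⟩⟩

theorem bddDeriv_of_eq_clm {f : V → F} (hf : ContDiff ℝ ∞ f) (A : V →L[ℝ] F) {K : Set V}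
    (hK : IsCompact K) (h : ∀ x, x ∉ K → f x = A x) : BddDeriv f := by
  have h1 : BddDeriv (fun x => f x - A x) :=
    bddDeriv_of_hasCompactSupport (hf.sub A.contDiff)
      (HasCompactSupport.intro hK fun x hx => by rw [h x hx, sub_self])
  simpa using h1.add (bddDeriv_clm A)

end BddDeriv

/-! ### Post-composition as a smooth map between spaces of continuous curves. -/

section Nemytskii

universe u

variable {T : Type*} [TopologicalSpace T] [CompactSpace T] {V : Type u} [NormedAddCommGroup V]
  [NormedSpace ℝ V]

/-- Pointwise application of a family of operators to a family of vectors. -/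
noncomputable def pointwiseApply (T : Type*) [TopologicalSpace T] [CompactSpace T]
    (V F : Type*) [NormedAddCommGroup V] [NormedSpace ℝ V] [NormedAddCommGroup F]
    [NormedSpace ℝ F] : C(T, V →L[ℝ] F) →L[ℝ] C(T, V) →L[ℝ] C(T, F) :=
  LinearMap.mkContinuous₂
    (LinearMap.mk₂ ℝ (fun (A : C(T, V →L[ℝ] F)) (η : C(T, V)) =>
        (⟨fun t => A t (η t), A.continuous.clm_apply η.continuous⟩ : C(T, F)))
      (fun _ _ _ => by ext; simp) (fun _ _ _ => by ext; simp) (fun _ _ _ => by ext; simp)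
      (fun _ _ _ => by ext; simp)) 1 (fun A η => by
      rw [one_mul]
      refine (ContinuousMap.norm_le _ (by positivity)).2 fun t => ?_
      exact ((A t).le_opNorm _).trans (by gcongr <;> apply ContinuousMap.norm_coe_le_norm))

theorem norm_pointwiseApply_le {F : Type*} [NormedAddCommGroup F] [NormedSpace ℝ F]
    (A : C(T, V →L[ℝ] F)) : ‖pointwiseApply T V F A‖ ≤ ‖A‖ := by
  refine ContinuousLinearMap.opNorm_le_bound _ (norm_nonneg A) fun η => ?_
  refine (ContinuousMap.norm_le _ (by positivity)).2 fun t => ?_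
  exact ((A t).le_opNorm _).trans (by gcongr <;> apply ContinuousMap.norm_coe_le_norm)

/-- Post-composition `γ ↦ X ∘ γ` on continuous curves. -/
def postComp (T : Type*) [TopologicalSpace T] {V F : Type*} [TopologicalSpace V]
    [TopologicalSpace F] {X : V → F} (hX : Continuous X) (γ : C(T, V)) : C(T, F) :=
  ContinuousMap.comp ⟨X, hX⟩ γ

omit [CompactSpace T] in
@[simp] theorem postComp_apply {V F : Type*} [TopologicalSpace V]
    [TopologicalSpace F] {X : V → F} (hX : Continuous X) (γ : C(T, V)) (t : T) :
    postComp T hX γ t = X (γ t) := rfl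

/-- The quadratic Taylor remainder of X has a global constant, so the pointwise estimate is uniform
in the parameter of the curve. -/
theorem hasFDerivAt_postComp {F : Type*} [NormedAddCommGroup F] [NormedSpace ℝ F] {X : V → F}
    (hX : BddDeriv X) (γ : C(T, V)) :
    HasFDerivAt (postComp T hX.1.continuous)
      (pointwiseApply T V F (postComp T hX.fderiv.1.continuous γ)) γ := by
  obtain ⟨C, hC0, hC⟩ := hX.taylor
  refine Asymptotics.IsLittleO.of_bound ?_ |> HasFDerivAt.of_isLittleO
  intro c hc
  have h0 : Tendsto (fun γ' : C(T, V) => C * ‖γ' - γ‖) (𝓝 γ) (𝓝 0) := by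
    have : Continuous fun γ' : C(T, V) => C * ‖γ' - γ‖ := by fun_prop
    simpa using this.tendsto γ
  filter_upwards [h0.eventually_lt_const hc] with γ' hγ'
  refine (ContinuousMap.norm_le _ (by positivity)).2 fun t => ?_
  have h1 := hC (γ t) (γ' t - γ t)
  have h2 : ‖γ' t - γ t‖ ≤ ‖γ' - γ‖ := ContinuousMap.norm_coe_le_norm (γ' - γ) t
  rw [add_sub_cancel] at h1
  calc _ ≤ C * ‖γ' t - γ t‖ ^ 2 := h1
    _ ≤ C * ‖γ' - γ‖ ^ 2 := by gcongr
    _ = (C * ‖γ' - γ‖) * ‖γ' - γ‖ := by ring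
    _ ≤ c * ‖γ' - γ‖ := by gcongr

/-- The derivative is again a post-composition, with DX, followed by a bounded linear map. As DX
inherits `BddDeriv`, the order of smoothness increases by induction. -/
theorem contDiff_postComp {F : Type u} [NormedAddCommGroup F] [NormedSpace ℝ F] {X : V → F}
    (hX : BddDeriv X) : ContDiff ℝ ∞ (postComp T hX.1.continuous) := by
  rw [contDiff_infty]
  intro n
  induction n generalizing F with
  | zero =>
    exact contDiff_zero.2 (continuous_iff_continuousAt.2
      fun γ => (hasFDerivAt_postComp hX γ).continuousAt)
  | succ n ih =>
    push_cast
    rw [contDiff_succ_iff_hasFDerivAt]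
    refine ⟨_, ?_, fun γ => hasFDerivAt_postComp hX γ⟩
    exact (pointwiseApply T V F).contDiff.comp (ih hX.fderiv)

end Nemytskii

end Nelson

/-! ### Joint smoothness of the flow, by the implicit function theorem. -/

namespace Nelson

open Set Metric MeasureTheory NNReal

universe u

variable {V : Type u} [NormedAddCommGroup V] [NormedSpace ℝ V]

/-- The operator sending `η` to its primitive `τ ↦ ∫₀^τ η`. -/
noncomputable def primitive (V : Type*) [NormedAddCommGroup V] [NormedSpace ℝ V] :
    C(unitInterval, V) →L[ℝ] C(unitInterval, V) :=
  have hi : ∀ (η : C(unitInterval, V)) (a b : ℝ), IntervalIntegrable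
      (fun t => η (projIcc 0 1 zero_le_one t)) volume a b := fun η a b =>
    (η.continuous.comp continuous_projIcc).intervalIntegrable a b
  LinearMap.mkContinuous
    { toFun := fun η => ⟨fun τ => ∫ t in (0 : ℝ)..τ, η (projIcc 0 1 zero_le_one t),
        (intervalIntegral.continuous_primitive (hi η) 0).comp continuous_subtype_val⟩
      map_add' := fun η ξ => by
        ext τ
        simpa using intervalIntegral.integral_add (hi η 0 τ) (hi ξ 0 τ)
      map_smul' := fun c η => by
        ext τ
        simp } 1 (fun η => by
      rw [one_mul]
      refine (ContinuousMap.norm_le _ (norm_nonneg _)).2 fun τ => ?_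
      refine (intervalIntegral.norm_integral_le_of_norm_le_const
        (fun t _ => η.norm_coe_le_norm _)).trans ?_
      rw [sub_zero, abs_of_nonneg τ.2.1]
      exact mul_le_of_le_one_right (norm_nonneg _) τ.2.2)

theorem primitive_apply (η : C(unitInterval, V)) (τ : unitInterval) :
    primitive V η τ = ∫ t in (0 : ℝ)..τ, η (projIcc 0 1 zero_le_one t) := rfl

theorem norm_primitive_le : ‖primitive V‖ ≤ 1 := by
  refine ContinuousLinearMap.opNorm_le_bound _ zero_le_one fun η => ?_
  rw [one_mul]
  refine (ContinuousMap.norm_le _ (norm_nonneg _)).2 fun τ => ?_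
  rw [primitive_apply]
  refine (intervalIntegral.norm_integral_le_of_norm_le_const
    (fun t _ => η.norm_coe_le_norm _)).trans ?_
  rw [sub_zero, abs_of_nonneg τ.2.1]
  exact mul_le_of_le_one_right (norm_nonneg _) τ.2.2

/-- The map vanishing exactly at the solutions `γ` of `γ τ = x + s ∫₀^τ X ∘ γ`. -/
noncomputable def integralDefect {X : V → V} (hX : Continuous X)
    (p : (ℝ × V) × C(unitInterval, V)) : C(unitInterval, V) :=
  p.2 - ContinuousMap.const _ p.1.2 - p.1.1 • primitive V (postComp _ hX p.2)

theorem contDiff_const_continuousMap {T : Type*} [TopologicalSpace T] [CompactSpace T] :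
    ContDiff ℝ ∞ (fun x : V => ContinuousMap.const T x) := by
  let L : V →L[ℝ] C(T, V) := LinearMap.mkContinuous
    { toFun := fun x => ContinuousMap.const T x
      map_add' := fun _ _ => rfl
      map_smul' := fun _ _ => rfl } 1 (fun x => by
        rw [one_mul]
        exact (ContinuousMap.norm_le _ (norm_nonneg _)).2 fun _ => le_rfl)
  exact L.contDiff

theorem contDiff_integralDefect {X : V → V} (hX : BddDeriv X) :
    ContDiff ℝ ∞ (integralDefect hX.1.continuous) := by
  have h1 : ContDiff ℝ ∞ fun p : (ℝ × V) × C(unitInterval, V) =>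
      primitive V (postComp unitInterval hX.1.continuous p.2) :=
    (primitive V).contDiff.comp ((contDiff_postComp hX).comp contDiff_snd)
  have h2 : ContDiff ℝ ∞ fun p : (ℝ × V) × C(unitInterval, V) =>
      ContinuousMap.const unitInterval p.1.2 :=
    contDiff_const_continuousMap.comp (contDiff_snd.comp contDiff_fst)
  exact (contDiff_snd.sub h2).sub ((contDiff_fst.comp contDiff_fst).smul h1)

/-- The partial derivative in the curve is 1 - T with ‖T‖ ≤ |s| C < 1, hence invertible by the
Neumann series. -/
theorem isInvertible_fderiv_integralDefect [CompleteSpace V] {X : V → V} (hX : BddDeriv X) {C : ℝ≥0}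
    (hC : ∀ x, ‖fderiv ℝ X x‖ ≤ C) (p : (ℝ × V) × C(unitInterval, V)) (hp : |p.1.1| * C < 1) :
    (fderiv ℝ (integralDefect hX.1.continuous) p ∘L
      .inr ℝ (ℝ × V) C(unitInterval, V)).IsInvertible := by
  set T : C(unitInterval, V) →L[ℝ] C(unitInterval, V) :=
    p.1.1 • (primitive V ∘L pointwiseApply unitInterval V V
      (postComp _ hX.fderiv.1.continuous p.2)) with hT
  have hTn : ‖T‖ < 1 := by
    refine lt_of_le_of_lt ?_ hp
    refine (ContinuousLinearMap.opNorm_smul_le _ _).trans ?_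
    rw [Real.norm_eq_abs]
    gcongr
    refine (ContinuousLinearMap.opNorm_comp_le _ _).trans ?_
    rw [← one_mul (C : ℝ)]
    gcongr
    · exact norm_primitive_le
    · refine (norm_pointwiseApply_le _).trans ?_
      exact (ContinuousMap.norm_le _ C.2).2 fun t => hC _
  have hd : fderiv ℝ (integralDefect hX.1.continuous) p ∘L
      .inr ℝ (ℝ × V) C(unitInterval, V) = 1 - T := by
    have h1 : HasFDerivAt (fun γ => integralDefect hX.1.continuous (p.1, γ))
        (fderiv ℝ (integralDefect hX.1.continuous) p ∘L .inr ℝ (ℝ × V) C(unitInterval, V)) p.2 :=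
      HasFDerivAt.comp (f := fun γ => (p.1, γ)) p.2
        ((contDiff_integralDefect hX).differentiable (by simp) p).hasFDerivAt
        (hasFDerivAt_prodMk_right p.1 p.2)
    have h2 : HasFDerivAt (fun γ => integralDefect hX.1.continuous (p.1, γ)) (1 - T) p.2 := by
      exact ((hasFDerivAt_id p.2).sub_const (ContinuousMap.const _ p.1.2)).sub
        (((primitive V).hasFDerivAt.comp p.2 (hasFDerivAt_postComp hX p.2)).const_smul p.1.1)
    exact h1.unique h2
  rw [hd]
  exact ⟨ContinuousLinearEquiv.ofUnit (Units.oneSub T hTn), rfl⟩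

namespace IsFlow

variable {X : V → V} {U : ℝ → V → V}

/-- The trajectory of `x`, run at speed `s` during a unit of time. -/
def curve (hU : IsFlow X U) (p : ℝ × V) : C(unitInterval, V) :=
  ⟨fun τ => U (p.1 * τ) p.2,
    (hU.continuous_time p.2).comp (continuous_const.mul continuous_subtype_val)⟩

theorem integralDefect_curve [CompleteSpace V] (hU : IsFlow X U) (hX : Continuous X) (p : ℝ × V) :
    integralDefect hX (p, hU.curve p) = 0 := by
  ext τ
  have h : ∀ t : ℝ, HasDerivAt (fun t => U (p.1 * t) p.2) (p.1 • X (U (p.1 * t) p.2)) t := fun t =>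
    (hU.hasDerivAt p.2 (p.1 * t)).scomp t (by simpa using (hasDerivAt_id t).const_mul p.1)
  have hc : Continuous fun t => p.1 • X (U (p.1 * t) p.2) :=
    (hX.comp ((hU.continuous_time p.2).comp (continuous_const.mul continuous_id))).const_smul _
  have h2 := intervalIntegral.integral_eq_sub_of_hasDerivAt (a := 0) (b := (τ : ℝ))
    (fun t _ => h t) (hc.intervalIntegrable _ _)
  have h3 : ∫ t in (0 : ℝ)..τ, postComp unitInterval hX (hU.curve p) (projIcc 0 1 zero_le_one t) =
      ∫ t in (0 : ℝ)..τ, X (U (p.1 * t) p.2) := by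
    refine intervalIntegral.integral_congr fun t ht => ?_
    rw [uIcc_of_le τ.2.1] at ht
    simp [curve, projIcc_of_mem zero_le_one ⟨ht.1, ht.2.trans τ.2.2⟩]
  rw [intervalIntegral.integral_smul] at h2
  simp only [integralDefect, ContinuousMap.coe_sub, ContinuousMap.coe_smul, Pi.sub_apply,
    Pi.smul_apply, primitive_apply, h3, h2, ContinuousMap.coe_zero, Pi.zero_apply]
  simp [curve, (hU p.2).1]

/-- For short times the integral equation is a contraction. Its uniqueness identifies the implicit
function with the flow. -/
theorem eq_curve [CompleteSpace V] (hU : IsFlow X U) {C : ℝ≥0} (hX : LipschitzWith C X) {p : ℝ × V}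
    (hp : |p.1| * C < 1) {γ : C(unitInterval, V)} (h : integralDefect hX.continuous (p, γ) = 0) :
    γ = hU.curve p := by
  have h0 := hU.integralDefect_curve hX.continuous p
  set δ := hU.curve p
  have h1 : γ - δ = p.1 • primitive V (postComp _ hX.continuous γ - postComp _ hX.continuous δ) := by
    rw [map_sub, smul_sub]
    simp only [integralDefect] at h h0
    rw [sub_sub, sub_eq_zero] at h h0
    nth_rewrite 1 [h, h0]
    abel
  have h2 : ‖γ - δ‖ ≤ |p.1| * C * ‖γ - δ‖ := by
    nth_rewrite 1 [h1]
    rw [norm_smul, Real.norm_eq_abs, mul_assoc]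
    gcongr
    refine ((primitive V).le_opNorm _).trans ?_
    rw [← one_mul (C * ‖γ - δ‖)]
    gcongr
    · exact norm_primitive_le
    · refine (ContinuousMap.norm_le _ (by positivity)).2 fun t => ?_
      refine (hX.norm_sub_le (γ t) (δ t)).trans ?_
      gcongr
      exact (γ - δ).norm_coe_le_norm t
  have h3 : ‖γ - δ‖ = 0 := by nlinarith [norm_nonneg (γ - δ)]
  exact sub_eq_zero.1 (norm_eq_zero.1 h3)

theorem contDiffAt_of_small [CompleteSpace V] (hU : IsFlow X U) (hX : BddDeriv X) {C : ℝ≥0}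
    (hC : ∀ x, ‖fderiv ℝ X x‖ ≤ C) {p : ℝ × V} (hp : |p.1| * C < 1) :
    ContDiffAt ℝ ∞ (fun p : ℝ × V => U p.1 p.2) p := by
  have hL : LipschitzWith C X :=
    lipschitzWith_of_nnnorm_fderiv_le (hX.1.differentiable (by simp)) fun x => hC x
  have h1 : ContDiffAt ℝ ∞ (integralDefect hX.1.continuous) (p, hU.curve p) :=
    (contDiff_integralDefect hX).contDiffAt
  have hinv := isInvertible_fderiv_integralDefect hX hC (p, hU.curve p) hp
  have h2 := h1.contDiffAt_implicitFunction (by simp) hinv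
  have h3 := h1.eventually_apply_implicitFunction (by simp) hinv
  have h4 : ∀ᶠ q : ℝ × V in 𝓝 p, |q.1| * C < 1 :=
    (by fun_prop : Continuous fun q : ℝ × V => |q.1| * C).continuousAt.eventually_lt_const hp
  have h5 : ContDiffAt ℝ ∞ hU.curve p := by
    refine h2.congr_of_eventuallyEq ?_
    filter_upwards [h3, h4] with q hq hq'
    rw [hU.integralDefect_curve] at hq
    exact (hU.eq_curve hL hq' hq).symm
  have h6 := (ContinuousMap.evalCLM ℝ (1 : unitInterval) :
    C(unitInterval, V) →L[ℝ] V).contDiff.contDiffAt.comp p h5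
  refine h6.congr_of_eventuallyEq (Eventually.of_forall fun q => ?_)
  simp [curve]

theorem contDiff_iterate {f : ℝ → V → V} {s : Set ℝ}
    (hf : ContDiffOn ℝ ∞ (fun p : ℝ × V => f p.1 p.2) (s ×ˢ univ)) (n : ℕ) :
    ContDiffOn ℝ ∞ (fun p : ℝ × V => (f p.1)^[n] p.2) (s ×ˢ univ) := by
  induction n with
  | zero => simpa using contDiffOn_snd
  | succ n ih =>
    simp only [Function.iterate_succ_apply']
    exact hf.comp (contDiffOn_fst.prodMk ih) fun p hp => ⟨hp.1, mem_univ _⟩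

/-- The flow of a smooth field with bounded derivatives is jointly smooth. -/
theorem contDiff [CompleteSpace V] (hU : IsFlow X U) (hX : BddDeriv X) :
    ContDiff ℝ ∞ (fun p : ℝ × V => U p.1 p.2) := by
  obtain ⟨C, hC⟩ := hX.norm_fderiv_le
  have hL : LipschitzWith C X :=
    lipschitzWith_of_nnnorm_fderiv_le (hX.1.differentiable (by simp)) fun x => hC x
  have hs : IsOpen {s : ℝ | |s| * C < 1} := isOpen_lt (by fun_prop) continuous_const
  rw [contDiff_iff_contDiffAt]
  rintro ⟨t, x⟩
  -- Time t is split into n short times: U t is the n-th iterate of U (t / n), where the short-time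
  -- result applies.
  obtain ⟨n, hn⟩ := exists_nat_gt (|t| * C)
  have hn0 : (0 : ℝ) < n := lt_of_le_of_lt (by positivity) hn
  have h1 := contDiff_iterate (s := {s : ℝ | |s| * C < 1}) (f := U) (fun p hp =>
    (hU.contDiffAt_of_small hX hC hp.1).contDiffWithinAt) n
  have h2 : ContDiffAt ℝ ∞ (fun p : ℝ × V => (U p.1)^[n] p.2) (t / n, x) :=
    (h1 (t / n, x) ⟨by
      simp only [mem_ofPred_eq, abs_div, Nat.abs_cast]
      rwa [div_mul_eq_mul_div, div_lt_one hn0], mem_univ _⟩).contDiffAt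
      ((hs.prod isOpen_univ).mem_nhds ⟨by
        simp only [mem_ofPred_eq, abs_div, Nat.abs_cast]
        rwa [div_mul_eq_mul_div, div_lt_one hn0], mem_univ _⟩)
  have h3 : ContDiffAt ℝ ∞ (fun p : ℝ × V => (p.1 / n, p.2)) (t, x) := by fun_prop
  refine (ContDiffAt.comp (t, x) h2 h3).congr_of_eventuallyEq (Eventually.of_forall fun q => ?_)
  simp only [Function.comp]
  rw [← hU.iterate hL, mul_div_cancel₀ _ hn0.ne']

theorem contDiff_space [CompleteSpace V] (hU : IsFlow X U) (hX : BddDeriv X) (t : ℝ) :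
    ContDiff ℝ ∞ (U t) :=
  (hU.contDiff hX).comp (contDiff_prodMk_right t)

end IsFlow

end Nelson

/-! ### Quantitative chain rules and flat functions. -/

namespace Nelson

open Set Metric MeasureTheory NNReal

universe u

section Estimates

variable {V : Type u} [NormedAddCommGroup V] [NormedSpace ℝ V] {F : Type u} [NormedAddCommGroup F]
  [NormedSpace ℝ F]

theorem ContDiff.at_nat {f : V → F} (hf : ContDiff ℝ ∞ f) (k : ℕ) (x : V) : ContDiffAt ℝ k f x :=
  hf.contDiffAt.of_le (mod_cast le_top)

/-- The bound of `norm_iteratedFDeriv_comp_le` for derivatives of positive order needs no bound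
on the values of the outer function. -/
theorem norm_iteratedFDeriv_comp_le_of_pos {E : Type u} [NormedAddCommGroup E] [NormedSpace ℝ E]
    {g : V → F} {f : E → V} {n : ℕ} (hn : 1 ≤ n) (hg : ContDiff ℝ ∞ g) (hf : ContDiff ℝ ∞ f) (x : E)
    {C D : ℝ} (hC : ∀ i, 1 ≤ i → i ≤ n → ‖iteratedFDeriv ℝ i g (f x)‖ ≤ C)
    (hD : ∀ i, 1 ≤ i → i ≤ n → ‖iteratedFDeriv ℝ i f x‖ ≤ D ^ i) :
    ‖iteratedFDeriv ℝ n (g ∘ f) x‖ ≤ n.factorial * C * D ^ n := by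
  -- Subtracting the value at the point kills the term of order zero and leaves the higher
  -- derivatives unchanged.
  set c := g (f x) with hc
  have hsub : ∀ {E' : Type _} [NormedAddCommGroup E'] [NormedSpace ℝ E'] (φ : E' → F)
      (i : ℕ) (y : E'), 1 ≤ i → ContDiff ℝ ∞ φ →
      iteratedFDeriv ℝ i (fun z => φ z - c) y = iteratedFDeriv ℝ i φ y := by
    intro E' _ _ φ i y hi hφ
    rw [fun_iteratedFDeriv_sub_apply (hφ.contDiffAt.of_le (mod_cast le_top)) contDiffAt_const,
      iteratedFDeriv_const_of_ne (by lia)]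
    simp
  have hC0 : 0 ≤ C := (norm_nonneg _).trans (hC 1 le_rfl hn)
  have h := norm_iteratedFDeriv_comp_le (g := fun z => g z - c) (f := f) (n := n) (N := ∞)
    (hg.sub contDiff_const) hf (mod_cast le_top) x (C := C) (D := D) (fun i hi => by
      rcases Nat.eq_zero_or_pos i with rfl | hi0
      · simpa [hc] using hC0
      · rw [hsub g i _ hi0 hg]; exact hC i hi0 hi) hD
  have h2 : (fun z => g z - c) ∘ f = fun z => (g ∘ f) z - c := rfl
  rwa [h2, hsub (g ∘ f) n x hn (hg.comp hf)] at h

theorem BddDeriv.exists_bound {V F : Type*} [NormedAddCommGroup V] [NormedSpace ℝ V]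
    [NormedAddCommGroup F] [NormedSpace ℝ F] {f : V → F} (hf : BddDeriv f) (j : ℕ) :
    ∃ C : ℝ, 1 ≤ C ∧ ∀ i, 1 ≤ i → i ≤ j → ∀ x, ‖iteratedFDeriv ℝ i f x‖ ≤ C := by
  induction j with
  | zero => exact ⟨1, le_rfl, fun i h1 h2 => by lia⟩
  | succ j ih =>
    obtain ⟨C, hC1, hC⟩ := ih
    obtain ⟨D, hD⟩ := hf.2 j
    refine ⟨max C D, hC1.trans (le_max_left _ _), fun i h1 h2 x => ?_⟩
    rcases Nat.lt_or_ge i (j + 1) with h | h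
    · exact (hC i h1 (by lia) x).trans (le_max_left _ _)
    · obtain rfl : i = j + 1 := by lia
      exact (hD x).trans (le_max_right _ _)

theorem norm_iteratedFDeriv_id_le (i : ℕ) (hi : 1 ≤ i) (x : V) :
    ‖iteratedFDeriv ℝ i (fun y : V => y) x‖ ≤ 1 := by
  obtain ⟨k, rfl⟩ : ∃ k, i = k + 1 := ⟨i - 1, by lia⟩
  cases k with
  | zero =>
    rw [zero_add, norm_iteratedFDeriv_one, fderiv_fun_id]
    exact ContinuousLinearMap.norm_id_le
  | succ k =>
    have := ContinuousLinearMap.norm_iteratedFDeriv_add_two (ContinuousLinearMap.id ℝ V) k x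
    rw [show (fun y : V => y) = ContinuousLinearMap.id ℝ V from rfl, this]
    simp

theorem contDiff_iterate_map {φ : V → V} (hφ : ContDiff ℝ ∞ φ) (n : ℕ) : ContDiff ℝ ∞ φ^[n] := by
  induction n with
  | zero => exact contDiff_id
  | succ n ih => rw [Function.iterate_succ']; exact hφ.comp ih

/-- The derivatives of the iterates of a map with bounded derivatives grow at most
exponentially. -/
theorem BddDeriv.iterate_bound {φ : V → V} (hφ : BddDeriv φ) (j : ℕ) :
    ∃ M : ℝ, 1 ≤ M ∧ ∀ n i : ℕ, 1 ≤ i → i ≤ j → ∀ x,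
      ‖iteratedFDeriv ℝ i (φ^[n]) x‖ ≤ (M ^ n) ^ i := by
  obtain ⟨C, hC1, hC⟩ := hφ.exists_bound j
  have hf1 : (1 : ℝ) ≤ j.factorial := by exact_mod_cast Nat.one_le_iff_ne_zero.2 j.factorial_ne_zero
  have hM : 1 ≤ j.factorial * C := one_le_mul_of_one_le_of_one_le hf1 hC1
  -- Each further composition costs the chain-rule factor i! C ≤ M ≤ M ^ i.
  refine ⟨j.factorial * C, hM, fun n => ?_⟩
  induction n with
  | zero =>
    intro i h1 _ x
    simpa using! norm_iteratedFDeriv_id_le i h1 x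
  | succ n ih =>
    intro i h1 h2 x
    rw [Function.iterate_succ']
    refine (norm_iteratedFDeriv_comp_le_of_pos h1 hφ.1 (contDiff_iterate_map hφ.1 n) x
      (fun k hk1 hk2 => hC k hk1 (hk2.trans h2) _)
      (fun k hk1 hk2 => ih k hk1 (hk2.trans h2) x)).trans ?_
    rw [pow_succ _ n, mul_pow _ _ i, mul_comm]
    gcongr
    calc (i.factorial : ℝ) * C ≤ j.factorial * C := by gcongr
      _ ≤ (j.factorial * C) ^ i := le_self_pow₀ hM (by lia)

/-- Two compositions `f ∘ u` and `f ∘ v` are close to order `k` at `x` if `u` and `v` are. -/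
theorem exists_comp_sub_bound (V : Type u) [NormedAddCommGroup V] [NormedSpace ℝ V] (k : ℕ) {B : ℝ}
    (hB : 1 ≤ B) :
    ∃ C : ℝ, 0 ≤ C ∧ ∀ (F : Type u) [NormedAddCommGroup F] [NormedSpace ℝ F] (f : V → F)
      (u v : V → V) (x : V) (A ε : ℝ), ContDiff ℝ ∞ f → ContDiff ℝ ∞ u → ContDiff ℝ ∞ v →
      0 ≤ A → 0 ≤ ε →
      (∀ i, 1 ≤ i → i ≤ k + 1 → ∀ y, ‖iteratedFDeriv ℝ i f y‖ ≤ A) →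
      (∀ i, 1 ≤ i → i ≤ k → ‖iteratedFDeriv ℝ i u x‖ ≤ B) →
      (∀ i, 1 ≤ i → i ≤ k → ‖iteratedFDeriv ℝ i v x‖ ≤ B) →
      (∀ i ≤ k, ‖iteratedFDeriv ℝ i (fun y => u y - v y) x‖ ≤ ε) →
      ∀ i ≤ k, ‖iteratedFDeriv ℝ i (fun y => f (u y) - f (v y)) x‖ ≤ C * A * ε := by
  induction k with
  | zero =>
    refine ⟨1, zero_le_one, ?_⟩
    intro F _ _ f u v x A ε hf hu hv hA hε hfA _ _ huv i hi
    obtain rfl : i = 0 := by lia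
    have h1 := huv 0 le_rfl
    rw [norm_iteratedFDeriv_zero] at h1 ⊢
    have h2 : LipschitzWith A.toNNReal f :=
      lipschitzWith_of_nnnorm_fderiv_le (hf.differentiable (by simp)) fun y => by
        have := hfA 1 le_rfl le_rfl y
        rw [norm_iteratedFDeriv_one] at this
        exact NNReal.coe_le_coe.1 (this.trans (Real.le_coe_toNNReal A))
    have h3 := h2.norm_sub_le (u x) (v x)
    rw [Real.coe_toNNReal _ hA] at h3
    rw [one_mul]
    exact h3.trans (by gcongr)
  | succ k ih =>
    obtain ⟨C, hC0, hC⟩ := ih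
    refine ⟨max C (2 ^ k * (C * B + k.factorial * B ^ k)),
      hC0.trans (le_max_left _ _), ?_⟩
    intro F _ _ f u v x A ε hf hu hv hA hε hfA huB hvB huv i hi
    rcases Nat.lt_or_ge i (k + 1) with hik | hik
    · refine (hC F f u v x A ε hf hu hv hA hε (fun i h1 h2 => hfA i h1 (by lia))
        (fun i h1 h2 => huB i h1 (by lia)) (fun i h1 h2 => hvB i h1 (by lia))
        (fun i h1 => huv i (by lia)) i (by lia)).trans ?_
      gcongr
      exact le_max_left _ _
    obtain rfl : i = k + 1 := by lia
    have hdf : ContDiff ℝ ∞ (fderiv ℝ f) := hf.fderiv_right (by simp)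
    have hdu : ContDiff ℝ ∞ (fderiv ℝ u) := hu.fderiv_right (by simp)
    have hdv : ContDiff ℝ ∞ (fderiv ℝ v) := hv.fderiv_right (by simp)
    -- The first summand falls under the induction hypothesis for Df, which is why the codomain F is
    -- quantified inside. The second is bounded directly by the Leibniz and chain rules.
    have hder : fderiv ℝ (fun y => f (u y) - f (v y)) = fun y =>
        ContinuousLinearMap.compL ℝ V V F (fderiv ℝ f (u y) - fderiv ℝ f (v y)) (fderiv ℝ u y) +
        ContinuousLinearMap.compL ℝ V V F (fderiv ℝ f (v y)) (fderiv ℝ u y - fderiv ℝ v y) := by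
      ext1 y
      have h1 := (hf.differentiable (by simp) (u y)).hasFDerivAt.comp y
        (hu.differentiable (by simp) y).hasFDerivAt
      have h2 := (hf.differentiable (by simp) (v y)).hasFDerivAt.comp y
        (hv.differentiable (by simp) y).hasFDerivAt
      refine (h1.sub h2).fderiv.trans ?_
      ext z
      simp
    have hder2 : (fun y => fderiv ℝ u y - fderiv ℝ v y) = fderiv ℝ (fun y => u y - v y) := by
      ext1 y
      rw [fderiv_fun_sub (hu.differentiable (by simp) y) (hv.differentiable (by simp) y)]
    have hP : ContDiff ℝ ∞ fun y => fderiv ℝ f (u y) - fderiv ℝ f (v y) :=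
      (hdf.comp hu).sub (hdf.comp hv)
    have hR : ContDiff ℝ ∞ fun y => fderiv ℝ f (v y) := hdf.comp hv
    have hS : ContDiff ℝ ∞ fun y => fderiv ℝ u y - fderiv ℝ v y := hdu.sub hdv
    have hPQ : ContDiff ℝ ∞ fun y => ContinuousLinearMap.compL ℝ V V F
        (fderiv ℝ f (u y) - fderiv ℝ f (v y)) (fderiv ℝ u y) := hP.clm_comp hdu
    have hRS : ContDiff ℝ ∞ fun y => ContinuousLinearMap.compL ℝ V V F
        (fderiv ℝ f (v y)) (fderiv ℝ u y - fderiv ℝ v y) := hR.clm_comp hS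
    have hsum : ∀ c : ℝ, ∑ i ∈ Finset.range (k + 1), (k.choose i : ℝ) * c = 2 ^ k * c := fun c => by
      rw [← Finset.sum_mul]; norm_cast; rw [Nat.sum_range_choose]
    have b1 := (ContinuousLinearMap.compL ℝ V V F).norm_iteratedFDeriv_le_of_bilinear_of_le_one
      hP hdu x (n := k) (mod_cast le_top) (ContinuousLinearMap.norm_compL_le ℝ V V F)
    have b2 := (ContinuousLinearMap.compL ℝ V V F).norm_iteratedFDeriv_le_of_bilinear_of_le_one
      hR hS x (n := k) (mod_cast le_top) (ContinuousLinearMap.norm_compL_le ℝ V V F)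
    have hP' := hC (V →L[ℝ] F) (fderiv ℝ f) u v x A ε hdf hu hv hA hε (fun i h1 h2 y => by
      rw [norm_iteratedFDeriv_fderiv]; exact hfA (i + 1) (by lia) (by lia) y)
      (fun i h1 h2 => huB i h1 (by lia)) (fun i h1 h2 => hvB i h1 (by lia))
      (fun i h1 => huv i (by lia))
    have c1 := b1.trans (Finset.sum_le_sum (g := fun i => (k.choose i : ℝ) * (C * A * ε * B))
      fun i hi => by
        rw [mul_assoc]
        have hi' := Finset.mem_range.1 hi
        gcongr
        · exact hP' i (by lia)
        · rw [norm_iteratedFDeriv_fderiv]; exact huB _ (by lia) (by lia))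
    have c2 := b2.trans (Finset.sum_le_sum
      (g := fun i => (k.choose i : ℝ) * (k.factorial * A * B ^ k * ε))
      fun i hi => by
        rw [mul_assoc]
        have hi' := Finset.mem_range.1 hi
        gcongr
        · refine (norm_iteratedFDeriv_comp_le (N := ∞) hdf hv (mod_cast le_top) x (C := A) (D := B)
            (fun l hl => ?_) (fun l h1 h2 => ?_)).trans ?_
          · rw [norm_iteratedFDeriv_fderiv]; exact hfA _ (by lia) (by lia) _
          · exact (hvB l h1 (by lia)).trans (le_self_pow₀ hB (by lia))
          · gcongr <;> lia
        · rw [hder2, norm_iteratedFDeriv_fderiv]; exact huv _ (by lia))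
    rw [hsum] at c1 c2
    rw [← norm_iteratedFDeriv_fderiv, hder, fun_iteratedFDeriv_add_apply]
    · refine (norm_add_le _ _).trans ((add_le_add c1 c2).trans ?_)
      calc _ = (2 ^ k * (C * B + k.factorial * B ^ k)) * A * ε := by ring
        _ ≤ _ := by gcongr; exact le_max_right _ _
    · exact ContDiff.at_nat hPQ _ _
    · exact ContDiff.at_nat hRS _ _

theorem VanishesToInfiniteOrderAt.fderiv {f : V → F} {x : V} (h : VanishesToInfiniteOrderAt f x) :
    VanishesToInfiniteOrderAt (fderiv ℝ f) x := fun j => by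
  rw [← norm_eq_zero, norm_iteratedFDeriv_fderiv, h, norm_zero]

theorem VanishesToInfiniteOrderAt.eq_zero {f : V → F} {x : V}
    (h : VanishesToInfiniteOrderAt f x) : f x = 0 := by
  rw [← norm_eq_zero, ← norm_iteratedFDeriv_zero (𝕜 := ℝ), h, norm_zero]

omit [NormedSpace ℝ V] [NormedSpace ℝ F] in
theorem exists_bound_closedBall [ProperSpace V] {f : V → F} (hf : Continuous f) (ρ : ℝ) :
    ∃ C : ℝ, 0 ≤ C ∧ ∀ y, ‖y‖ ≤ ρ → ‖f y‖ ≤ C := by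
  obtain ⟨C, hC⟩ := (isCompact_closedBall (0 : V) ρ).exists_bound_of_continuousOn hf.continuousOn
  exact ⟨max C 0, le_max_right _ _, fun y hy =>
    (hC y (mem_closedBall_zero_iff.2 hy)).trans (le_max_left _ _)⟩

/-- The derivative is flat as well; the mean value inequality on the ball of radius ‖y‖ gains one
power per induction step. -/
theorem VanishesToInfiniteOrderAt.norm_le [ProperSpace V] {f : V → F} (hf : ContDiff ℝ ∞ f)
    (h : VanishesToInfiniteOrderAt f 0) (m : ℕ) (ρ : ℝ) :
    ∃ C : ℝ, 0 ≤ C ∧ ∀ y, ‖y‖ ≤ ρ → ‖f y‖ ≤ C * ‖y‖ ^ m := by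
  induction m generalizing F with
  | zero => simpa using exists_bound_closedBall hf.continuous ρ
  | succ m ih =>
    obtain ⟨C, hC0, hC⟩ := ih (hf.fderiv_right (by simp)) h.fderiv
    refine ⟨C, hC0, fun y hy => ?_⟩
    have := (convex_closedBall (0 : V) ‖y‖).norm_image_sub_le_of_norm_fderiv_le (𝕜 := ℝ) (f := f)
      (C := C * ‖y‖ ^ m) (x := 0) (y := y) (fun z _ => hf.differentiable (by simp) z)
      (fun z hz => by
        rw [mem_closedBall_zero_iff] at hz
        refine (hC z (hz.trans hy)).trans ?_
        gcongr)
      (by simp) (by simp)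
    rw [h.eq_zero, sub_zero, sub_zero] at this
    rw [pow_succ, ← mul_assoc]
    exact this

theorem VanishesToInfiniteOrderAt.norm_iteratedFDeriv_le [ProperSpace V] {f : V → F}
    (hf : ContDiff ℝ ∞ f) (h : VanishesToInfiniteOrderAt f 0) (k m : ℕ) (ρ : ℝ) :
    ∃ C : ℝ, 0 ≤ C ∧ ∀ i ≤ k, ∀ y, ‖y‖ ≤ ρ → ‖iteratedFDeriv ℝ i f y‖ ≤ C * ‖y‖ ^ m := by
  induction k generalizing F with
  | zero =>
    obtain ⟨C, hC0, hC⟩ := h.norm_le hf m ρ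
    refine ⟨C, hC0, fun i hi y hy => ?_⟩
    obtain rfl : i = 0 := by lia
    simpa using hC y hy
  | succ k ih =>
    obtain ⟨C, hC0, hC⟩ := h.norm_le hf m ρ
    obtain ⟨D, hD0, hD⟩ := ih (hf.fderiv_right (by simp)) h.fderiv
    refine ⟨max C D, hC0.trans (le_max_left _ _), fun i hi y hy => ?_⟩
    cases i with
    | zero =>
      rw [norm_iteratedFDeriv_zero]
      refine (hC y hy).trans ?_
      gcongr
      exact le_max_left _ _
    | succ i =>
      rw [← norm_iteratedFDeriv_fderiv]
      refine (hD i (by lia) y hy).trans ?_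
      gcongr
      exact le_max_right _ _

theorem norm_taylor_le_closedBall {f : V → F} (hf : ContDiff ℝ ∞ f) {r C : ℝ} (hC0 : 0 ≤ C)
    (hC : ∀ y, ‖y‖ ≤ r → ‖iteratedFDeriv ℝ 2 f y‖ ≤ C) {x h : V} (hx : ‖x‖ ≤ r)
    (hxh : ‖x + h‖ ≤ r) : ‖f (x + h) - f x - fderiv ℝ f x h‖ ≤ C * ‖h‖ ^ 2 := by
  have hdf : ContDiff ℝ ∞ (fderiv ℝ f) := hf.fderiv_right (by simp)
  have hseg : segment ℝ x (x + h) ⊆ closedBall 0 r :=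
    (convex_closedBall (0 : V) r).segment_subset (by simpa using hx) (by simpa using hxh)
  have := (convex_segment x (x + h)).norm_image_sub_le_of_norm_fderiv_le' (𝕜 := ℝ) (f := f)
    (C := C * ‖h‖) (φ := fderiv ℝ f x) (x := x) (y := x + h)
    (fun y _ => (hf.differentiable (by simp)) y) (fun y hy => by
      refine ((convex_closedBall (0 : V) r).norm_image_sub_le_of_norm_fderiv_le (𝕜 := ℝ)
        (f := fderiv ℝ f) (C := C) (x := x) (y := y)
        (fun z _ => hdf.differentiable (by simp) z) (fun z hz => ?_)
        (by simpa using hx) (hseg hy)).trans ?_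
      · have := hC z (by simpa using hz)
        rwa [← norm_iteratedFDeriv_fderiv, norm_iteratedFDeriv_one] at this
      · gcongr
        simpa using norm_sub_le_of_mem_segment hy)
    (left_mem_segment ..) (right_mem_segment ..)
  simpa [pow_two, mul_assoc] using this

/-- A family with locally uniformly bounded derivatives that is uniformly `O(‖y‖ ^ m)` for every
`m` has derivatives with the same property. -/
theorem exists_fderiv_bound_of_flat {S : Type*} {f : S → V → F} (hf : ∀ s, ContDiff ℝ ∞ (f s))
    (hb : ∀ (k : ℕ) (ρ : ℝ), ∃ C : ℝ, 0 ≤ C ∧ ∀ s y, ‖y‖ ≤ ρ → ‖iteratedFDeriv ℝ k (f s) y‖ ≤ C)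
    (h0 : ∀ (m : ℕ) (ρ : ℝ), ∃ C : ℝ, 0 ≤ C ∧ ∀ s y, ‖y‖ ≤ ρ → ‖f s y‖ ≤ C * ‖y‖ ^ m)
    (m : ℕ) (ρ : ℝ) : ∃ C : ℝ, 0 ≤ C ∧ ∀ s y, ‖y‖ ≤ ρ → ‖fderiv ℝ (f s) y‖ ≤ C * ‖y‖ ^ m := by
  cases m with
  | zero =>
    obtain ⟨C, hC0, hC⟩ := hb 1 ρ
    exact ⟨C, hC0, fun s y hy => by simpa using hC s y hy⟩
  | succ m =>
    obtain ⟨C, hC0, hC⟩ := hb 2 (2 * |ρ|)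
    obtain ⟨D, hD0, hD⟩ := h0 (2 * (m + 1)) (2 * |ρ|)
    set R := 1 + |ρ| with hR
    have hR1 : 1 ≤ R := by simp [hR]
    set a := R ^ (m + 1) with ha
    have ha1 : 1 ≤ a := one_le_pow₀ hR1
    refine ⟨C + D * (2 ^ (2 * (m + 1)) + 1) * a, by positivity, fun s y hy => ?_⟩
    have hyR : ‖y‖ ≤ |ρ| := hy.trans (le_abs_self ρ)
    rcases eq_or_ne y 0 with rfl | hy0
    · have : HasFDerivAt (f s) (0 : V →L[ℝ] F) 0 := by
        obtain ⟨D, hD0, hD⟩ := h0 2 1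
        refine Asymptotics.IsBigO.hasFDerivAt (n := 2) (Asymptotics.IsBigO.of_bound D ?_) one_lt_two
        filter_upwards [closedBall_mem_nhds (0 : V) one_pos] with z hz
        simpa using hD s z (by simpa using hz)
      rw [this.fderiv]
      simp
    have hy1 : 0 < ‖y‖ := norm_pos_iff.2 hy0
    -- Landau interpolation: a difference quotient of step t has Taylor error C t and value error of
    -- order ‖y‖ ^ (2(m+1)) / t. This step makes both of order ‖y‖ ^ (m+1), and the divisor a
    -- ensures t ≤ ‖y‖, so that y + tv stays in the ball of radius 2‖y‖.
    set t := ‖y‖ ^ (m + 1) / a with ht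
    have ht0 : 0 < t := by positivity
    have ht1 : t ≤ ‖y‖ := by
      rw [ht, div_le_iff₀ (by positivity), pow_succ, mul_comm]
      gcongr
      exact (pow_le_pow_left₀ (norm_nonneg _) (by linarith : ‖y‖ ≤ R) m).trans
        (pow_le_pow_right₀ hR1 (by lia))
    have ht2 : t ≤ ‖y‖ ^ (m + 1) := div_le_self (by positivity) ha1
    refine ContinuousLinearMap.opNorm_le_of_unit_norm (by positivity) fun v hv => ?_
    have htv : ‖t • v‖ = t := by rw [norm_smul, hv, mul_one, Real.norm_of_nonneg ht0.le]
    have hytv : ‖y + t • v‖ ≤ 2 * ‖y‖ := by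
      refine (norm_add_le _ _).trans ?_
      rw [htv]; linarith
    have h1 := norm_taylor_le_closedBall (hf s) hC0 (hC s) (x := y) (h := t • v) (r := 2 * |ρ|)
      (by linarith [abs_nonneg ρ]) (by linarith)
    rw [htv, map_smul] at h1
    have h2 := hD s (y + t • v) (by linarith)
    have h3 := hD s y (by linarith [abs_nonneg ρ])
    have h4 : ‖t • fderiv ℝ (f s) y v‖ ≤ C * t ^ 2 + D * ‖y + t • v‖ ^ (2 * (m + 1)) +
        D * ‖y‖ ^ (2 * (m + 1)) := by
      have : t • fderiv ℝ (f s) y v = -(f s (y + t • v) - f s y - t • fderiv ℝ (f s) y v) +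
        f s (y + t • v) - f s y := by abel
      rw [this]
      refine (norm_sub_le _ _).trans (add_le_add ((norm_add_le _ _).trans (add_le_add ?_ h2)) h3)
      rwa [norm_neg]
    have h5 : D * ‖y + t • v‖ ^ (2 * (m + 1)) ≤ D * (2 ^ (2 * (m + 1)) * ‖y‖ ^ (2 * (m + 1))) := by
      rw [← mul_pow]
      gcongr
    rw [norm_smul, Real.norm_of_nonneg ht0.le] at h4
    have h6 : ‖y‖ ^ (2 * (m + 1)) = t * (a * ‖y‖ ^ (m + 1)) := by
      rw [ht]; field_simp; ring
    rw [h6] at h4 h5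
    have h7 : t * ‖fderiv ℝ (f s) y v‖ ≤ t * (C * t + D * (2 ^ (2 * (m + 1)) + 1) * a *
      ‖y‖ ^ (m + 1)) := by linarith
    refine (le_of_mul_le_mul_left h7 ht0).trans ?_
    rw [add_mul]
    gcongr

theorem exists_iteratedFDeriv_bound_of_flat {S : Type*} {f : S → V → F}
    (hf : ∀ s, ContDiff ℝ ∞ (f s))
    (hb : ∀ (k : ℕ) (ρ : ℝ), ∃ C : ℝ, 0 ≤ C ∧ ∀ s y, ‖y‖ ≤ ρ → ‖iteratedFDeriv ℝ k (f s) y‖ ≤ C)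
    (h0 : ∀ (m : ℕ) (ρ : ℝ), ∃ C : ℝ, 0 ≤ C ∧ ∀ s y, ‖y‖ ≤ ρ → ‖f s y‖ ≤ C * ‖y‖ ^ m)
    (k m : ℕ) (ρ : ℝ) :
    ∃ C : ℝ, 0 ≤ C ∧ ∀ i ≤ k, ∀ s y, ‖y‖ ≤ ρ → ‖iteratedFDeriv ℝ i (f s) y‖ ≤ C * ‖y‖ ^ m := by
  induction k generalizing F with
  | zero =>
    obtain ⟨C, hC0, hC⟩ := h0 m ρ
    refine ⟨C, hC0, fun i hi s y hy => ?_⟩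
    obtain rfl : i = 0 := by lia
    simpa using hC s y hy
  | succ k ih =>
    obtain ⟨C, hC0, hC⟩ := h0 m ρ
    obtain ⟨D, hD0, hD⟩ := ih (f := fun s => fderiv ℝ (f s))
      (fun s => (hf s).fderiv_right (by simp)) (fun k ρ => by
        obtain ⟨C, hC0, hC⟩ := hb (k + 1) ρ
        exact ⟨C, hC0, fun s y hy => by rw [norm_iteratedFDeriv_fderiv]; exact hC s y hy⟩)
      (exists_fderiv_bound_of_flat hf hb h0)
    refine ⟨max C D, hC0.trans (le_max_left _ _), fun i hi s y hy => ?_⟩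
    cases i with
    | zero =>
      rw [norm_iteratedFDeriv_zero]
      refine (hC s y hy).trans ?_
      gcongr
      exact le_max_left _ _
    | succ i =>
      rw [← norm_iteratedFDeriv_fderiv]
      refine (hD i (by lia) s y hy).trans ?_
      gcongr
      exact le_max_right _ _

/-- The partial derivatives of a smooth function are continuous jointly in all variables. -/
theorem continuous_iteratedFDeriv_snd {f : ℝ → V → F}
    (hf : ContDiff ℝ ∞ (fun p : ℝ × V => f p.1 p.2)) (k : ℕ) :
    Continuous fun p : ℝ × V => iteratedFDeriv ℝ k (f p.1) p.2 := by
  induction k generalizing F with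
  | zero =>
    simp only [iteratedFDeriv_zero_eq_comp]
    exact (continuousMultilinearCurryFin0 ℝ V F).symm.continuous.comp hf.continuous
  | succ k ih =>
    simp only [iteratedFDeriv_succ_eq_comp_right]
    have h1 : ContDiff ℝ ∞ (fun p : ℝ × V => fderiv ℝ (f p.1) p.2) :=
      ContDiff.fderiv (n := ∞) (m := ∞) (f := fun p : ℝ × V => f p.1)
        (hf.comp ((contDiff_fst.comp contDiff_fst).prodMk contDiff_snd)) contDiff_snd (by simp)
    exact (continuousMultilinearCurryRightEquiv' ℝ k V F).symm.continuous.comp (ih (f := fun s y => fderiv ℝ (f s) y) h1)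

end Estimates

end Nelson

/-! ### Comparison of the two flows over bounded times, and with the linear flow. -/

namespace Nelson

open Set Metric MeasureTheory NNReal

universe u

variable {V : Type u} [NormedAddCommGroup V] [NormedSpace ℝ V]

theorem gronwallBound_zero_one_nonneg (K : ℝ≥0) {t : ℝ} (ht : 0 ≤ t) :
    0 ≤ gronwallBound 0 K 1 t := by
  have := gronwallBound_mono (δ := 0) (K := K) (ε := 1) le_rfl zero_le_one K.2 ht
  simpa [gronwallBound_x0] using this

namespace IsFlow

variable {X X₀ : V → V} {U U₀ : ℝ → V → V}

theorem norm_le (hU : IsFlow X U) {K : ℝ≥0} (hK : LipschitzWith K X) (h0 : X 0 = 0) (t : ℝ) (x : V) :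
    ‖U t x‖ ≤ Real.exp (K * |t|) * ‖x‖ := by
  have := (hU.lipschitz hK t).norm_sub_le x 0
  rw [hU.fixed hK h0, Real.coe_toNNReal _ (Real.exp_pos _).le] at this
  simpa using this

/-- A trajectory of X₀ solves the equation of X up to an error O(‖y‖ ^ m), so Gronwall bounds U₀ s y
- U s y. The Lipschitz map U (-s) carries this back to y. -/
theorem exists_wave_sub_bound [ProperSpace V] (hU : IsFlow X U) (hU₀ : IsFlow X₀ U₀)
    (hX : BddDeriv X) (hX₀ : BddDeriv X₀) (h0 : X₀ 0 = 0)
    (hflat : VanishesToInfiniteOrderAt (fun x => X x - X₀ x) 0) (S : ℝ) (m : ℕ) (ρ : ℝ) :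
    ∃ C : ℝ, 0 ≤ C ∧ ∀ s : Icc 0 S, ∀ y, ‖y‖ ≤ ρ → ‖U (-s) (U₀ s y) - y‖ ≤ C * ‖y‖ ^ m := by
  obtain ⟨K, hK⟩ := hX.lipschitz
  obtain ⟨K₀, hK₀⟩ := hX₀.lipschitz
  set R := Real.exp (K₀ * |S|) with hR
  obtain ⟨C, hC0, hC⟩ := hflat.norm_le (hX.1.sub hX₀.1) m (R * ρ)
  refine ⟨Real.exp (K * |S|) * (C * R ^ m * gronwallBound 0 K 1 |S|), ?_, ?_⟩
  · have := gronwallBound_zero_one_nonneg K (abs_nonneg S)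
    positivity
  rintro ⟨s, hs0, hsS⟩ y hy
  have hR1 : ∀ t ∈ Icc 0 s, ‖U₀ t y‖ ≤ R * ‖y‖ := fun t ht => by
    refine (hU₀.norm_le hK₀ h0 t y).trans ?_
    have : |t| ≤ |S| := abs_le_abs_of_nonneg ht.1 (ht.2.trans hsS)
    rw [hR]
    gcongr
  have h1 := hU.dist_le_of_approx hK (S := s) (fun t => hU₀.hasDerivAt y t)
    (ε := C * R ^ m * ‖y‖ ^ m) (fun t ht => by
      rw [norm_sub_rev]
      refine (hC _ ((hR1 t ht).trans (by gcongr))).trans ?_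
      rw [mul_assoc, ← mul_pow]
      gcongr
      exact hR1 t ht) (t := s) ⟨hs0, le_rfl⟩
  rw [(hU₀ y).1] at h1
  have h2 := (hU.lipschitz hK (-s)).norm_sub_le (U₀ s y) (U s y)
  rw [hU.neg_cancel hK, Real.coe_toNNReal _ (Real.exp_pos _).le] at h2
  refine h2.trans ?_
  have hgr : gronwallBound 0 K 1 s ≤ gronwallBound 0 K 1 |S| :=
    gronwallBound_mono le_rfl zero_le_one K.2 (hsS.trans (le_abs_self S))
  calc _ ≤ Real.exp (K * |S|) * (C * R ^ m * ‖y‖ ^ m * gronwallBound 0 K 1 |S|) := by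
        have hs : |(-s)| ≤ |S| := by rw [abs_neg]; exact abs_le_abs_of_nonneg hs0 hsS
        have h3 : C * R ^ m * ‖y‖ ^ m * gronwallBound 0 K 1 s ≤
          C * R ^ m * ‖y‖ ^ m * gronwallBound 0 K 1 |S| := by gcongr
        gcongr
        exact h1.trans h3
    _ = _ := by ring

theorem contDiff_wave [CompleteSpace V] (hU : IsFlow X U) (hU₀ : IsFlow X₀ U₀)
    (hX : BddDeriv X) (hX₀ : BddDeriv X₀) :
    ContDiff ℝ ∞ (fun p : ℝ × V => U (-p.1) (U₀ p.1 p.2)) :=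
  (hU.contDiff hX).comp (contDiff_fst.neg.prodMk (hU₀.contDiff hX₀))

/-- `U (-s) ∘ U₀ s` is the identity to infinite order at `0`, uniformly for bounded `s`. -/
theorem exists_iteratedFDeriv_wave_sub_bound [ProperSpace V] [CompleteSpace V] (hU : IsFlow X U)
    (hU₀ : IsFlow X₀ U₀) (hX : BddDeriv X) (hX₀ : BddDeriv X₀) (h0 : X₀ 0 = 0)
    (hflat : VanishesToInfiniteOrderAt (fun x => X x - X₀ x) 0) (S : ℝ) (k m : ℕ) (ρ : ℝ) :
    ∃ C : ℝ, 0 ≤ C ∧ ∀ i ≤ k, ∀ s ∈ Icc 0 S, ∀ y, ‖y‖ ≤ ρ →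
      ‖iteratedFDeriv ℝ i (fun y => U (-s) (U₀ s y) - y) y‖ ≤ C * ‖y‖ ^ m := by
  have hsm : ContDiff ℝ ∞ (fun p : ℝ × V => U (-p.1) (U₀ p.1 p.2) - p.2) :=
    (hU.contDiff_wave hU₀ hX hX₀).sub contDiff_snd
  obtain ⟨C, hC0, hC⟩ := exists_iteratedFDeriv_bound_of_flat (S := Icc 0 S)
    (f := fun s y => U (-s) (U₀ s y) - y) (fun s => hsm.comp (contDiff_prodMk_right (s : ℝ)))
    (fun k ρ => by
      have hc := continuous_iteratedFDeriv_snd (f := fun s y => U (-s) (U₀ s y) - y) hsm k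
      obtain ⟨C, hC⟩ := ((isCompact_Icc (a := 0) (b := S)).prod
        (isCompact_closedBall (0 : V) ρ)).exists_bound_of_continuousOn hc.continuousOn
      exact ⟨max C 0, le_max_right _ _, fun s y hy =>
        (hC (s, y) ⟨s.2, mem_closedBall_zero_iff.2 hy⟩).trans (le_max_left _ _)⟩)
    (hU.exists_wave_sub_bound hU₀ hX hX₀ h0 hflat S) k m ρ
  exact ⟨C, hC0, fun i hi s hs y hy => hC i hi ⟨s, hs⟩ y hy⟩

/-- The flow of a linear field is linear. -/
theorem exists_clm {A : V →L[ℝ] V} (hU : IsFlow A U) (t : ℝ) : ∃ B : V →L[ℝ] V, ⇑B = U t := by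
  have hadd : ∀ x y, U t (x + y) = U t x + U t y := fun x y => by
    have h : IsIntegralCurve (fun t => U t x + U t y) (fun _ => A) := fun s => by
      have := (hU.hasDerivAt x s).add (hU.hasDerivAt y s)
      rwa [← map_add] at this
    simpa [(hU _).1] using hU.eq_of_integralCurve A.lipschitz h t
  have hsmul : ∀ (c : ℝ) x, U t (c • x) = c • U t x := fun c x => by
    have h : IsIntegralCurve (fun t => c • U t x) (fun _ => A) := fun s => by
      have := (hU.hasDerivAt x s).const_smul c
      rwa [← map_smul] at this
    simpa [(hU _).1] using hU.eq_of_integralCurve A.lipschitz h t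
  exact ⟨⟨⟨⟨U t, hadd⟩, hsmul⟩, (hU.lipschitz A.lipschitz t).continuous⟩, rfl⟩

theorem le_norm {A : V →L[ℝ] V} (hU : IsFlow A U) (t : ℝ) (x : V) :
    Real.exp (-(‖A‖ * |t|)) * ‖x‖ ≤ ‖U t x‖ := by
  have h := hU.norm_le A.lipschitz (map_zero A) (-t) (U t x)
  rw [hU.neg_cancel A.lipschitz, abs_neg] at h
  rw [Real.exp_neg, inv_mul_le_iff₀ (Real.exp_pos _)]
  exact h

/-- Trajectories of the linear field that stay where the two fields agree are trajectories of the
other field. -/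
theorem eq_linear {A : V →L[ℝ] V} {UA : ℝ → V → V} (hU : IsFlow X U) {K : ℝ≥0}
    (hK : LipschitzWith K X) (hA : IsFlow A UA) {x : V} {S : ℝ} (hS : 0 ≤ S)
    (h : ∀ t ∈ Icc 0 S, X (UA t x) = A (UA t x)) : U S x = UA S x := by
  have := hU.dist_le_of_approx hK (S := S) (hA.hasDerivAt x) (ε := 0)
    (fun t ht => by rw [h t ht, sub_self, norm_zero]) ⟨hS, le_rfl⟩
  rw [(hA x).1, zero_mul, norm_le_zero_iff, sub_eq_zero] at this
  exact this.symm

/-- A linear trajectory starting outside the ball of radius r exp(‖A‖ t) cannot enter K before time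
t. There U t coincides with the linear flow, so it is linear outside a compact set. -/
theorem bddDeriv_of_nonneg [ProperSpace V] [CompleteSpace V] (hU : IsFlow X U) (hX : ContDiff ℝ ∞ X)
    (A : V →L[ℝ] V) {K : Set V} (hK : IsCompact K) (hXA : ∀ x, x ∉ K → X x = A x) {t : ℝ}
    (ht : 0 ≤ t) : BddDeriv (U t) := by
  have hb := bddDeriv_of_eq_clm hX A hK hXA
  obtain ⟨L, hL⟩ := hb.lipschitz
  have hA : IsFlow A (flow A) := isFlow_flow A.contDiff A.lipschitz
  obtain ⟨B, hB⟩ := hA.exists_clm t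
  obtain ⟨r, hr⟩ := hK.isBounded.subset_closedBall 0
  refine bddDeriv_of_eq_clm (hU.contDiff_space hb t) B
    (isCompact_closedBall 0 (r * Real.exp (‖A‖ * t))) fun x hx => ?_
  rw [hB]
  refine hU.eq_linear hL hA ht fun s hs => hXA _ fun hmem => hx ?_
  have h1 : ‖flow A s x‖ ≤ r := by simpa using hr hmem
  have h2 := (hA.le_norm s x).trans h1
  rw [Real.exp_neg, inv_mul_le_iff₀ (Real.exp_pos _), abs_of_nonneg hs.1, mul_comm] at h2
  have hr0 : 0 ≤ r := (norm_nonneg _).trans h1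
  rw [mem_closedBall_zero_iff]
  refine h2.trans ?_
  gcongr
  exact hs.2

theorem bddDeriv [ProperSpace V] [CompleteSpace V] (hU : IsFlow X U) (hX : ContDiff ℝ ∞ X)
    (A : V →L[ℝ] V) {K : Set V} (hK : IsCompact K) (hXA : ∀ x, x ∉ K → X x = A x) (t : ℝ) :
    BddDeriv (U t) := by
  rcases le_total 0 t with ht | ht
  · exact hU.bddDeriv_of_nonneg hX A hK hXA ht
  · simpa using hU.neg.bddDeriv_of_nonneg hX.neg (-A) hK
      (fun x hx => by simp [hXA x hx]) (t := -t) (by linarith)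

/-- A subspace invariant under a field is invariant under its flow. -/
theorem mem_of_invariant [CompleteSpace V] (hU : IsFlow X U) (hX : BddDeriv X) {E : Submodule ℝ V}
    [CompleteSpace E] (P : V →L[ℝ] E) (hP : ∀ x : E, P x = x) (hinv : ∀ x ∈ E, X x ∈ E) (t : ℝ)
    {x : V} (hx : x ∈ E) : U t x ∈ E := by
  obtain ⟨K, hK⟩ := hX.lipschitz
  -- The projected field lives on E and has global curves there. By invariance they are also curves
  -- of X, and uniqueness applies.
  set Y : E → E := fun x => P (X x) with hY
  have hY1 : ContDiff ℝ 1 Y :=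
    P.contDiff.comp ((hX.1.of_le (by simp)).comp E.subtypeL.contDiff)
  have hY2 : LipschitzWith (‖P‖₊ * K * 1) Y :=
    (P.lipschitz.comp hK).comp (LipschitzWith.subtype_val _)
  obtain ⟨γ, h0, hγ⟩ := exists_integralCurve hY1 hY2 ⟨x, hx⟩
  have h : IsIntegralCurve (fun t => (γ t : V)) (fun _ => X) := fun t => by
    have h1 : HasDerivAt (fun t => (γ t : V)) (Y (γ t) : V) t :=
      E.subtypeL.hasFDerivAt.comp_hasDerivAt t (hγ t)
    have h2 : (Y (γ t) : V) = X (γ t) := by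
      rw [hY]
      exact congrArg Subtype.val (hP ⟨X (γ t), hinv _ (γ t).2⟩)
    rwa [h2] at h1
  have h3 := hU.eq_of_integralCurve hK h t
  simp only [h0] at h3
  rw [h3]
  exact (γ t).2

end IsFlow

/-! ### Exponential decay on the invariant subspace. -/

omit [NormedSpace ℝ V] in
theorem exists_bounded_index {S : Set V} (hS : IsCompact S) {P : ℕ → V → Prop}
    (hP : ∀ n, IsOpen {x | P n x}) (h : ∀ x ∈ S, ∃ n, 1 ≤ n ∧ P n x) :
    ∃ N, 1 ≤ N ∧ ∀ x ∈ S, ∃ n, 1 ≤ n ∧ n ≤ N ∧ P n x := by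
  obtain ⟨t, ht⟩ := hS.elim_finite_subcover (fun n : ℕ => {x | 1 ≤ n ∧ P n x})
    (fun n => isOpen_const.inter (hP n)) (fun x hx => by
      obtain ⟨n, hn⟩ := h x hx
      exact mem_iUnion.2 ⟨n, hn⟩)
  refine ⟨t.sup id + 1, by lia, fun x hx => ?_⟩
  obtain ⟨n, hn, hn1, hn2⟩ := mem_iUnion₂.1 (ht hx)
  exact ⟨n, hn1, (Finset.le_sup (f := id) hn).trans (by simp), hn2⟩

omit [NormedSpace ℝ V] in
/-- If every point is brought closer to the origin by a factor `1 / 2` in a bounded number of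
steps, the orbits decay geometrically. -/
theorem exists_geometric_decay {u : ℕ → V → V} (hu : ∀ m n x, u (m + n) x = u m (u n x))
    {S : Set V} {N : ℕ} (hN : 1 ≤ N) {L : ℝ} (hL : 0 ≤ L) (hu1 : ∀ n ≤ N, ∀ x, ‖u n x‖ ≤ L * ‖x‖)
    (hS : ∀ x ∈ S, ∃ n, 1 ≤ n ∧ n ≤ N ∧ ‖u n x‖ ≤ ‖x‖ / 2 ∧ u n x ∈ S) :
    ∃ θ : ℝ, 0 < θ ∧ θ < 1 ∧ ∀ n, ∀ x ∈ S, ‖u n x‖ ≤ 2 * L * θ ^ n * ‖x‖ := by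
  have hN0 : (1 : ℝ) ≤ N := by exact_mod_cast hN
  have hN1 : (1 : ℝ) / (2 * N) ≤ 1 / 2 := by
    rw [div_le_div_iff₀ (by positivity) (by positivity)]; linarith
  -- By Bernoulli θ ^ N ≥ 1 / 2, so a halving achieved in k ≤ N steps is at least as good as the
  -- factor θ ^ k.
  set θ : ℝ := 1 - 1 / (2 * N) with hθ
  have hθ1 : θ < 1 := by
    have : (0 : ℝ) < 1 / (2 * N) := by positivity
    rw [hθ]; linarith
  have hθ0 : 0 < θ := by rw [hθ]; linarith
  have hθN : 1 / 2 ≤ θ ^ N := by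
    have := one_add_mul_le_pow (a := -(1 / (2 * N) : ℝ)) (by linarith) N
    rw [← sub_eq_add_neg, ← hθ] at this
    refine le_trans (le_of_eq ?_) this
    field_simp; norm_num
  have hθk : ∀ k ≤ N, 1 / 2 ≤ θ ^ k := fun k hk =>
    hθN.trans (pow_le_pow_of_le_one hθ0.le hθ1.le hk)
  refine ⟨θ, hθ0, hθ1, fun n => ?_⟩
  induction n using Nat.strong_induction_on with
  | _ n ih =>
    intro x hx
    rcases le_or_gt n N with hn | hn
    · refine (hu1 n hn x).trans ?_
      have := hθk n hn
      gcongr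
      nlinarith
    · obtain ⟨k, hk1, hkN, hk2, hkS⟩ := hS x hx
      have h1 : u n x = u (n - k) (u k x) := by rw [← hu]; congr 1; lia
      rw [h1]
      refine (ih (n - k) (by lia) _ hkS).trans ?_
      have h2 : θ ^ n = θ ^ (n - k) * θ ^ k := by rw [← pow_add]; congr 1; lia
      have h3 := hθk k hkN
      calc 2 * L * θ ^ (n - k) * ‖u k x‖ ≤ 2 * L * θ ^ (n - k) * (θ ^ k * ‖x‖) := by
            gcongr
            refine hk2.trans ?_
            nlinarith [norm_nonneg x]
        _ = _ := by rw [h2]; ring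

namespace IsFlow

variable {X : V → V} {U UA : ℝ → V → V} {A : V →L[ℝ] V} {K : Set V}

/-- If the linear orbit of v never shrank, a large multiple of v would have a linear orbit that
stays away from K. It would then be a trajectory of the nonlinear field as well, contradicting its
convergence to 0. -/
theorem exists_linear_contraction (hU : IsFlow X U) {L : ℝ≥0} (hL : LipschitzWith L X)
    (hA : IsFlow A UA) (hK : IsCompact K) (hXA : ∀ x, x ∉ K → X x = A x) {v : V} (hv : v ≠ 0)
    (hcontr : ∀ c : ℝ, Tendsto (fun t : ℝ => U t (c • v)) atTop (𝓝 0)) :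
    ∃ n : ℕ, 1 ≤ n ∧ ‖UA n v‖ < ‖v‖ / 4 := by
  by_contra! hcon
  obtain ⟨r, hr⟩ := hK.isBounded.subset_closedBall 0
  have hv0 : 0 < ‖v‖ := norm_pos_iff.2 hv
  -- The lower bound at positive integer times extends to real t ≥ 0: the integer ⌈t⌉ + 1 is at most
  -- 2 later, and the flow grows by at most exp(2‖A‖) meanwhile.
  set c : ℝ := Real.exp (-(‖A‖ * 2)) * (‖v‖ / 4) with hc
  have hc0 : 0 < c := by positivity
  have h1 : ∀ t : ℝ, 0 ≤ t → c ≤ ‖UA t v‖ := fun t ht => by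
    have h2 := hcon (⌈t⌉₊ + 1) (by lia)
    have h3 := hA.norm_le A.lipschitz (map_zero A) (((⌈t⌉₊ + 1 : ℕ) : ℝ) - t) (UA t v)
    rw [← hA.add A.lipschitz, sub_add_cancel] at h3
    have h4 : |((⌈t⌉₊ + 1 : ℕ) : ℝ) - t| ≤ 2 := by
      push_cast
      rw [abs_le]
      constructor <;> linarith [Nat.le_ceil t, Nat.ceil_lt_add_one ht]
    rw [hc, Real.exp_neg, inv_mul_le_iff₀ (Real.exp_pos _)]
    refine h2.trans (h3.trans ?_)
    gcongr
    simp
  set s : ℝ := (|r| + 1) / c with hs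
  have hs0 : 0 < s := by positivity
  have h5 : ∀ t : ℝ, 0 ≤ t → |r| + 1 ≤ ‖UA t (s • v)‖ := fun t ht => by
    obtain ⟨B, hB⟩ := hA.exists_clm t
    rw [← hB, map_smul, hB, norm_smul, Real.norm_of_nonneg hs0.le, hs, div_mul_eq_mul_div,
      le_div_iff₀ hc0]
    gcongr
    exact h1 t ht
  have h6 : ∀ t : ℝ, 0 ≤ t → U t (s • v) = UA t (s • v) := fun t ht =>
    hU.eq_linear hL hA ht fun τ hτ => hXA _ fun hmem => by
      have h7 : ‖UA τ (s • v)‖ ≤ r := by simpa using hr hmem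
      linarith [h5 τ hτ.1, le_abs_self r]
  have h8 := (hcontr s).norm.eventually_lt_const (u := 1) (by simp)
  obtain ⟨t, ht1, ht2⟩ := (h8.and (eventually_ge_atTop 0)).exists
  rw [h6 t ht2] at ht1
  linarith [h5 t ht2, abs_nonneg r]

/-- Compactness of the unit sphere of E bounds the time in which the linear flow contracts by 1/4.
Over that time the nonlinear flow differs from it by O(‖x‖²), which is at most ‖x‖/4 near 0. -/
theorem exists_local_contraction [ProperSpace V] [CompleteSpace V] (hU : IsFlow X U)
    (hX : BddDeriv X) (h0 : X 0 = 0)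
    (hA0 : fderiv ℝ X 0 = A) (hK : IsCompact K) (hXA : ∀ x, x ∉ K → X x = A x)
    {E : Submodule ℝ V} (hE : IsClosed (E : Set V))
    (hcontr : ∀ x ∈ E, Tendsto (fun t : ℝ => U t x) atTop (𝓝 0)) :
    ∃ (δ : ℝ) (N : ℕ), 0 < δ ∧ 1 ≤ N ∧ ∀ x ∈ E, ‖x‖ ≤ δ →
      ∃ n, 1 ≤ n ∧ n ≤ N ∧ ‖U n x‖ ≤ ‖x‖ / 2 := by
  obtain ⟨L, hL⟩ := hX.lipschitz
  have hA : IsFlow A (flow A) := isFlow_flow A.contDiff A.lipschitz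
  obtain ⟨N, hN1, hN⟩ := exists_bounded_index (S := sphere (0 : V) 1 ∩ E)
    (P := fun n v => ‖flow A n v‖ < 1 / 4) ((isCompact_sphere 0 1).inter_right hE)
    (fun n => isOpen_lt (hA.lipschitz A.lipschitz n).continuous.norm continuous_const)
    (fun v hv => by
      have hv1 : ‖v‖ = 1 := by simpa using hv.1
      have := exists_linear_contraction hU hL hA hK hXA (v := v) (by
        rintro rfl; simp at hv1) (fun c => hcontr _ (E.smul_mem c hv.2))
      rwa [hv1] at this)
  obtain ⟨C, hC0, hC⟩ := hX.taylor
  set R := Real.exp (‖A‖ * N) with hR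
  set D := C * R ^ 2 * gronwallBound 0 L 1 N with hD
  have hg := gronwallBound_zero_one_nonneg L (Nat.cast_nonneg (α := ℝ) N)
  have hD0 : 0 ≤ D := by positivity
  have happ : ∀ n ≤ N, ∀ x, ‖flow A n x - U n x‖ ≤ D * ‖x‖ ^ 2 := fun n hn x => by
    have hnN : (n : ℝ) ≤ N := by exact_mod_cast hn
    have h1 := hU.dist_le_of_approx hL (S := n) (fun t => hA.hasDerivAt x t)
      (ε := C * (R * ‖x‖) ^ 2) (fun t ht => by
        have h2 := hC 0 (flow A t x)
        rw [zero_add, h0, sub_zero, hA0, norm_sub_rev] at h2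
        refine h2.trans ?_
        gcongr
        refine (hA.norm_le A.lipschitz (map_zero A) t x).trans ?_
        rw [abs_of_nonneg ht.1, coe_nnnorm, hR]
        gcongr
        exact ht.2.trans hnN) (t := n) ⟨Nat.cast_nonneg n, le_rfl⟩
    rw [(hA x).1] at h1
    refine h1.trans ?_
    calc _ ≤ C * (R * ‖x‖) ^ 2 * gronwallBound 0 L 1 N := by
          gcongr
          exact gronwallBound_mono le_rfl zero_le_one L.2 hnN
      _ = _ := by rw [hD]; ring
  refine ⟨1 / (4 * (D + 1)), N, by positivity, hN1, fun x hxE hx => ?_⟩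
  rcases eq_or_ne x 0 with rfl | hx0
  · exact ⟨1, le_rfl, hN1, by rw [hU.fixed hL h0]; simp⟩
  have hx1 : 0 < ‖x‖ := norm_pos_iff.2 hx0
  obtain ⟨n, hn1, hnN, hn⟩ := hN (‖x‖⁻¹ • x)
    ⟨by simp [norm_smul, hx1.ne'], E.smul_mem _ hxE⟩
  refine ⟨n, hn1, hnN, ?_⟩
  have h3 : ‖flow A n x‖ ≤ ‖x‖ / 4 := by
    obtain ⟨B, hB⟩ := hA.exists_clm n
    rw [← hB] at hn ⊢
    rw [map_smul, norm_smul, norm_inv, norm_norm, inv_mul_lt_iff₀ hx1] at hn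
    linarith
  have h4 := happ n hnN x
  have h5 : D * ‖x‖ ^ 2 ≤ ‖x‖ / 4 := by
    rw [le_div_iff₀ (by positivity)] at hx
    nlinarith
  have h6 := norm_sub_norm_le (U n x) (flow A n x)
  rw [norm_sub_rev] at h6
  linarith

/-- On an invariant subspace of points converging to `0` the convergence is exponential, locally
uniformly. -/
theorem exists_exponential_decay [ProperSpace V] [CompleteSpace V] (hU : IsFlow X U)
    (hX : BddDeriv X) (h0 : X 0 = 0)
    (hA0 : fderiv ℝ X 0 = A) (hK : IsCompact K) (hXA : ∀ x, x ∉ K → X x = A x)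
    {E : Submodule ℝ V} (hE : IsClosed (E : Set V)) (hinv : ∀ t, ∀ x ∈ E, U t x ∈ E)
    (hcontr : ∀ x ∈ E, Tendsto (fun t : ℝ => U t x) atTop (𝓝 0)) (R : ℝ) :
    ∃ C θ : ℝ, 0 ≤ C ∧ 0 < θ ∧ θ < 1 ∧ ∀ n : ℕ, ∀ x ∈ E, ‖x‖ ≤ R → ‖U n x‖ ≤ C * θ ^ n := by
  obtain ⟨L, hL⟩ := hX.lipschitz
  obtain ⟨δ, N₁, hδ, hN₁, h1⟩ := hU.exists_local_contraction hX h0 hA0 hK hXA hE hcontr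
  obtain ⟨N₂, hN₂, h2⟩ := exists_bounded_index (S := closedBall (0 : V) R ∩ E)
    (P := fun n x => ‖U n x‖ < δ / 2) ((isCompact_closedBall 0 R).inter_right hE)
    (fun n => isOpen_lt (hU.lipschitz hL n).continuous.norm continuous_const)
    (fun x hx => by
      have h3 := (hcontr x hx.2).norm.comp tendsto_natCast_atTop_atTop
      obtain ⟨n, hn, hn1⟩ := ((h3.eventually_lt_const (u := δ / 2) (by simpa using hδ)).and
        (eventually_ge_atTop 1)).exists
      exact ⟨n, hn1, hn⟩)
  set N := max N₁ N₂ with hN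
  obtain ⟨θ, hθ0, hθ1, h3⟩ := exists_geometric_decay (u := fun n => U n)
    (S := closedBall (0 : V) R ∩ E) (N := N) (L := Real.exp (L * N))
    (fun m n x => by simp only [Nat.cast_add]; rw [hU.add hL]) (hN₁.trans (le_max_left _ _))
    (Real.exp_pos _).le (fun n hn x => by
      refine (hU.norm_le hL h0 n x).trans ?_
      rw [Nat.abs_cast]
      gcongr)
    (fun x hx => by
      have hxR : ‖x‖ ≤ R := by simpa using hx.1
      -- Within δ of 0 the local contraction applies. Farther out, convergence and compactness bring
      -- the orbit below δ / 2 < ‖x‖ / 2.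
      have key : ∃ n, 1 ≤ n ∧ n ≤ N ∧ ‖U n x‖ ≤ ‖x‖ / 2 := by
        rcases le_or_gt ‖x‖ δ with hxδ | hxδ
        · obtain ⟨n, hn1, hn2, hn3⟩ := h1 x hx.2 hxδ
          exact ⟨n, hn1, hn2.trans (le_max_left _ _), hn3⟩
        · obtain ⟨n, hn1, hn2, hn3⟩ := h2 x hx
          exact ⟨n, hn1, hn2.trans (le_max_right _ _), by linarith⟩
      obtain ⟨n, hn1, hn2, hn3⟩ := key
      exact ⟨n, hn1, hn2, hn3, by
        rw [mem_closedBall_zero_iff]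
        linarith [norm_nonneg x], hinv _ x hx.2⟩)
  refine ⟨2 * Real.exp (L * N) * |R|, θ, by positivity, hθ0, hθ1, fun n x hxE hx => ?_⟩
  refine (h3 n x ⟨by simpa using hx, hxE⟩).trans ?_
  rw [mul_right_comm]
  gcongr
  exact hx.trans (le_abs_self R)

end IsFlow

end Nelson

namespace Nelson

open Set Metric MeasureTheory NNReal

universe u

variable {V : Type u} [NormedAddCommGroup V] [NormedSpace ℝ V]

/-! ### Termwise differentiation of series with locally summable bounds. -/

section Series

theorem contDiff_tsum_of_locally_bounded {F : Type u} [NormedAddCommGroup F] [NormedSpace ℝ F]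
    [CompleteSpace F] {f : ℕ → V → F} (hf : ∀ n, ContDiff ℝ ∞ (f n))
    (hb : ∀ (k : ℕ) (R : ℝ), ∃ v : ℕ → ℝ, Summable v ∧
      ∀ n z, ‖z‖ ≤ R → ‖iteratedFDeriv ℝ k (f n) z‖ ≤ v n) :
    ContDiff ℝ ∞ (fun z => ∑' n, f n z) ∧ ∀ k z,
      HasSum (fun n => iteratedFDeriv ℝ k (f n) z) (iteratedFDeriv ℝ k (fun z => ∑' n, f n z) z) := by
  have hsum : ∀ {F : Type u} [NormedAddCommGroup F] [NormedSpace ℝ F] [CompleteSpace F]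
      {f : ℕ → V → F} (_ : ∀ (k : ℕ) (R : ℝ), ∃ v : ℕ → ℝ, Summable v ∧
      ∀ n z, ‖z‖ ≤ R → ‖iteratedFDeriv ℝ k (f n) z‖ ≤ v n) (z : V), Summable fun n => f n z := by
    intro F _ _ _ f hb z
    obtain ⟨v, hv, hfv⟩ := hb 0 ‖z‖
    exact Summable.of_norm_bounded hv fun n => by simpa using hfv n z le_rfl
  have hb' : ∀ {F : Type u} [NormedAddCommGroup F] [NormedSpace ℝ F]
      {f : ℕ → V → F} (_ : ∀ (k : ℕ) (R : ℝ), ∃ v : ℕ → ℝ, Summable v ∧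
      ∀ n z, ‖z‖ ≤ R → ‖iteratedFDeriv ℝ k (f n) z‖ ≤ v n) (k : ℕ) (R : ℝ), ∃ v : ℕ → ℝ,
      Summable v ∧ ∀ n z, ‖z‖ ≤ R → ‖iteratedFDeriv ℝ k (fderiv ℝ (f n)) z‖ ≤ v n := by
    intro F _ _ f hb k R
    obtain ⟨v, hv, hfv⟩ := hb (k + 1) R
    exact ⟨v, hv, fun n z hz => by rw [norm_iteratedFDeriv_fderiv]; exact hfv n z hz⟩
  have hder : ∀ {F : Type u} [NormedAddCommGroup F] [NormedSpace ℝ F] [CompleteSpace F]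
      {f : ℕ → V → F} (_ : ∀ n, ContDiff ℝ ∞ (f n))
      (_ : ∀ (k : ℕ) (R : ℝ), ∃ v : ℕ → ℝ, Summable v ∧
      ∀ n z, ‖z‖ ≤ R → ‖iteratedFDeriv ℝ k (f n) z‖ ≤ v n) (z : V),
      HasFDerivAt (fun z => ∑' n, f n z) (∑' n, fderiv ℝ (f n) z) z := by
    intro F _ _ _ f hf hb z
    obtain ⟨v, hv, hfv⟩ := hb 1 (‖z‖ + 1)
    have hz : z ∈ ball (0 : V) (‖z‖ + 1) := by simp
    refine hasFDerivAt_tsum_of_isPreconnected hv isOpen_ball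
      (convex_ball (0 : V) (‖z‖ + 1)).isPreconnected
      (fun n x _ => ((hf n).differentiable (by simp) x).hasFDerivAt)
      (fun n x hx => ?_) hz (hsum hb z) hz
    rw [← norm_iteratedFDeriv_one]
    exact hfv n x (mem_ball_zero_iff.1 hx).le
  constructor
  · rw [contDiff_infty]
    intro m
    induction m generalizing F with
    | zero =>
      exact contDiff_zero.2 (continuous_iff_continuousAt.2 fun z => (hder hf hb z).continuousAt)
    | succ m ih =>
      push_cast
      rw [contDiff_succ_iff_hasFDerivAt]
      exact ⟨_, ih (fun n => (hf n).fderiv_right (by simp)) (hb' hb), fun z => hder hf hb z⟩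
  · intro k
    induction k generalizing F with
    | zero =>
      intro z
      simp only [iteratedFDeriv_zero_eq_comp]
      exact (hsum hb z).hasSum.mapL
        ((continuousMultilinearCurryFin0 ℝ V F).symm.toContinuousLinearEquiv :
          F →L[ℝ] ContinuousMultilinearMap ℝ (fun _ : Fin 0 => V) F)
    | succ k ih =>
      intro z
      simp only [iteratedFDeriv_succ_eq_comp_right]
      have h1 : (fun y => fderiv ℝ (fun z => ∑' n, f n z) y) = fun y => ∑' n, fderiv ℝ (f n) y :=
        funext fun y => (hder hf hb y).fderiv
      have h2 := ih (f := fun n => fderiv ℝ (f n)) (fun n => (hf n).fderiv_right (by simp))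
        (hb' hb) z
      have h3 := h2.mapL ((continuousMultilinearCurryRightEquiv' ℝ k V
        F).symm.toContinuousLinearEquiv.toContinuousLinearMap)
      simp only [Function.comp]
      rw [h1]
      exact h3

end Series

/-! ### Asymptotics of the comparison maps near the subspace. -/

/-- The asymptotic comparison of the flows `U` and `U₀` near the subspace `E`; the points at
distance `2 / b ^ n` from `E` are attracted to the origin during time `n`. -/
structure WaveData (X X₀ : V → V) (U U₀ : ℝ → V → V) (E : Submodule ℝ V) (P : V →L[ℝ] E)
    (b : ℝ) : Prop where
  flow : IsFlow X U
  flow₀ : IsFlow X₀ U₀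
  field : BddDeriv X
  field₀ : BddDeriv X₀
  zero : X₀ 0 = 0
  flat : VanishesToInfiniteOrderAt (fun x => X x - X₀ x) 0
  backward : BddDeriv (U (-1))
  forward : BddDeriv (U₀ 1)
  proj : ∀ x : E, P x = x
  one_le : 1 ≤ b
  decay : ∀ R : ℝ, ∃ C θ : ℝ, 0 ≤ C ∧ 0 < θ ∧ θ < 1 ∧ ∀ (n : ℕ) (z : V), ‖z‖ ≤ R →
    ‖z - P z‖ ≤ 2 / b ^ n → ‖U₀ n z‖ ≤ C * θ ^ n

/-- Exponential decay on `E` extends to shrinking neighbourhoods of `E`. -/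
theorem exists_decay_near {X₀ : V → V} {U₀ : ℝ → V → V} {E : Submodule ℝ V} (P : V →L[ℝ] E)
    (hU₀ : IsFlow X₀ U₀) (hX₀ : BddDeriv X₀)
    (hdecay : ∀ R : ℝ, ∃ C θ : ℝ, 0 ≤ C ∧ 0 < θ ∧ θ < 1 ∧ ∀ (n : ℕ), ∀ x ∈ E, ‖x‖ ≤ R →
      ‖U₀ n x‖ ≤ C * θ ^ n) :
    ∃ b : ℝ, 1 ≤ b ∧ ∀ R : ℝ, ∃ C θ : ℝ, 0 ≤ C ∧ 0 < θ ∧ θ < 1 ∧ ∀ (n : ℕ) (z : V), ‖z‖ ≤ R →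
      ‖z - P z‖ ≤ 2 / b ^ n → ‖U₀ n z‖ ≤ C * θ ^ n := by
  obtain ⟨K, hK⟩ := hX₀.lipschitz
  have he : 1 ≤ Real.exp K := Real.one_le_exp K.2
  -- The flow stretches the distance 2 / b ^ n by at most exp(K n) up to time n; this b leaves 2 ·
  -- 2⁻ⁿ.
  refine ⟨2 * Real.exp K, by linarith, fun R => ?_⟩
  obtain ⟨C, θ, hC, hθ0, hθ1, h⟩ := hdecay (‖P‖ * R)
  refine ⟨C + 2, max θ (1 / 2), by linarith, by positivity, max_lt hθ1 (by norm_num),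
    fun n z hz hzP => ?_⟩
  have h1 := h n (P z) (P z).2 ((P.le_opNorm z).trans (by gcongr))
  have h2 := (hU₀.lipschitz hK n).norm_sub_le z (P z)
  rw [Real.coe_toNNReal _ (Real.exp_pos _).le, Nat.abs_cast] at h2
  have h3 : Real.exp (K * n) * (2 / (2 * Real.exp K) ^ n) = 2 * (1 / 2) ^ n := by
    rw [mul_comm (K : ℝ), Real.exp_nat_mul, mul_pow, one_div, inv_pow]
    field_simp
  calc ‖U₀ n z‖ ≤ ‖U₀ n (P z)‖ + ‖U₀ n z - U₀ n (P z)‖ := by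
        simpa using norm_add_le (U₀ n (P z)) (U₀ n z - U₀ n (P z))
    _ ≤ C * θ ^ n + 2 * (1 / 2) ^ n := by
        refine add_le_add h1 (h2.trans ?_)
        rw [← h3]
        gcongr
    _ ≤ C * max θ (1 / 2) ^ n + 2 * max θ (1 / 2) ^ n := by
        gcongr
        · exact le_max_left _ _
        · exact le_max_right _ _
    _ = _ := by ring

/-- The comparison map `U (-t) ∘ U₀ t`. -/
def wave (U U₀ : ℝ → V → V) (t : ℝ) (y : V) : V := U (-t) (U₀ t y)

namespace WaveData

variable {X X₀ : V → V} {U U₀ : ℝ → V → V} {E : Submodule ℝ V} {P : V →L[ℝ] E} {b : ℝ}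

theorem wave_add (h : WaveData X X₀ U U₀ E P b) (s t : ℝ) (y : V) :
    wave U U₀ (s + t) y = U (-s) (wave U U₀ t (U₀ s y)) := by
  obtain ⟨K, hK⟩ := h.field.lipschitz
  obtain ⟨K₀, hK₀⟩ := h.field₀.lipschitz
  simp only [wave]
  rw [← h.flow.add hK, ← h.flow₀.add hK₀, add_comm t s, neg_add]

theorem wave_zero (h : WaveData X X₀ U U₀ E P b) : wave U U₀ 0 = fun y => y := by
  ext1 y
  simp [wave, (h.flow₀ y).1, (h.flow y).1]

theorem contDiff_wave [CompleteSpace V] (h : WaveData X X₀ U U₀ E P b) (t : ℝ) :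
    ContDiff ℝ ∞ (wave U U₀ t) :=
  (h.flow.contDiff_wave h.flow₀ h.field h.field₀).comp (contDiff_prodMk_right t)

theorem forward_iterate (h : WaveData X X₀ U U₀ E P b) (n : ℕ) : U₀ n = (U₀ 1)^[n] := by
  obtain ⟨K₀, hK₀⟩ := h.field₀.lipschitz
  rw [← h.flow₀.iterate hK₀, mul_one]

theorem backward_iterate (h : WaveData X X₀ U U₀ E P b) (n : ℕ) :
    U (-(n : ℝ)) = (U (-1))^[n] := by
  obtain ⟨K, hK⟩ := h.field.lipschitz
  rw [← h.flow.iterate hK, mul_neg_one]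

theorem exists_backward_bound (h : WaveData X X₀ U U₀ E P b) (k : ℕ) :
    ∃ M : ℝ, 1 ≤ M ∧ ∀ n i : ℕ, 1 ≤ i → i ≤ k → ∀ x,
      ‖iteratedFDeriv ℝ i (U (-(n : ℝ))) x‖ ≤ (M ^ k) ^ n := by
  obtain ⟨M, hM1, hM⟩ := h.backward.iterate_bound k
  refine ⟨M, hM1, fun n i h1 h2 x => ?_⟩
  rw [h.backward_iterate]
  refine (hM n i h1 h2 x).trans ?_
  rw [pow_right_comm]
  gcongr

/-- Bounds for derivatives at `U₀ n z` transport to bounds at `z`. -/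
theorem exists_transport_bound (h : WaveData X X₀ U U₀ E P b) (k : ℕ) :
    ∃ C M : ℝ, 0 ≤ C ∧ 1 ≤ M ∧ ∀ (n : ℕ) (f : V → V) (z : V) (c : ℝ), ContDiff ℝ ∞ f →
      (∀ i ≤ k, ‖iteratedFDeriv ℝ i f (U₀ n z)‖ ≤ c) →
      ∀ i ≤ k, ‖iteratedFDeriv ℝ i (fun y => f (U₀ n y)) z‖ ≤ C * c * M ^ n := by
  obtain ⟨M, hM1, hM⟩ := h.forward.iterate_bound k
  refine ⟨k.factorial, M ^ k, by positivity, one_le_pow₀ hM1, fun n f z c hf hc i hi => ?_⟩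
  have hc0 : 0 ≤ c := (norm_nonneg _).trans (hc 0 (Nat.zero_le _))
  rw [h.forward_iterate] at hc ⊢
  refine (norm_iteratedFDeriv_comp_le (N := ∞) hf (contDiff_iterate_map h.forward.1 n)
    (mod_cast le_top) z (C := c) (D := M ^ n) (fun l hl => hc l (hl.trans hi))
    (fun l h1 h2 => hM n l h1 (h2.trans hi) z)).trans ?_
  rw [pow_right_comm M k n]
  gcongr
  exact one_le_pow₀ hM1

/-- Chooses the order of flatness m: Λ collects the exponential growth rates, and θ ^ m must beat
them. -/
theorem exists_pow_le {θ Λ ρ : ℝ} (hθ1 : θ < 1) (hΛ : 0 < Λ) (hρ : 0 < ρ) :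
    ∃ m : ℕ, Λ * θ ^ m ≤ ρ := by
  obtain ⟨m, hm⟩ := exists_pow_lt_of_lt_one (div_pos hρ hΛ) hθ1
  exact ⟨m, by rw [mul_comm]; exact ((lt_div_iff₀ hΛ).1 hm).le⟩

/-- The increments of the comparison maps decay, with all derivatives, faster than any
exponential near `E`. -/
theorem exists_increment_bound [ProperSpace V] [CompleteSpace V] (h : WaveData X X₀ U U₀ E P b)
    (k : ℕ) (R : ℝ) {ρ : ℝ} (hρ : 0 < ρ) :
    ∃ C : ℝ, 0 ≤ C ∧ ∀ (n : ℕ), ∀ s ∈ Icc (0 : ℝ) 1, ∀ z, ‖z‖ ≤ R → ‖z - P z‖ ≤ 2 / b ^ n →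
      ∀ i ≤ k, ‖iteratedFDeriv ℝ i (fun y => wave U U₀ (n + s) y - wave U U₀ n y) z‖ ≤
        C * ρ ^ n := by
  obtain ⟨C₀, θ, hC₀, hθ0, hθ1, hθ⟩ := h.decay R
  obtain ⟨M₁, hM₁, hb⟩ := h.exists_backward_bound (k + 1)
  obtain ⟨C₂, M₂, hC₂, hM₂, ht⟩ := h.exists_transport_bound k
  -- Exponent 0 suffices here: only uniform bounds on the derivatives of `wave U U₀ s` are needed.
  -- The identity contributes the extra 1 in B + 1.
  obtain ⟨B, hB0, hB⟩ := h.flow.exists_iteratedFDeriv_wave_sub_bound h.flow₀ h.field h.field₀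
    h.zero h.flat 1 k 0 C₀
  obtain ⟨C₃, hC₃, hcomp⟩ := exists_comp_sub_bound V k (B := B + 1) (by linarith)
  obtain ⟨m, hm⟩ := exists_pow_le (Λ := M₁ ^ (k + 1) * M₂) hθ1 (by positivity) hρ
  obtain ⟨C₄, hC₄, hfl⟩ := h.flow.exists_iteratedFDeriv_wave_sub_bound h.flow₀ h.field h.field₀
    h.zero h.flat 1 k m C₀
  refine ⟨C₂ * C₃ * C₄ * C₀ ^ m, by positivity, fun n s hs z hz hzP i hi => ?_⟩
  have hy := hθ n z hz hzP
  have hy1 : ‖U₀ n z‖ ≤ C₀ := hy.trans (mul_le_of_le_one_right hC₀ (pow_le_one₀ hθ0.le hθ1.le))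
  have hw : ∀ y, wave U U₀ (n + s) y - wave U U₀ n y =
      (fun p => U (-(n : ℝ)) (wave U U₀ s p) - U (-(n : ℝ)) p) (U₀ n y) := fun y => by
    have h0 := h.wave_add n 0 y
    rw [add_zero, h.wave_zero] at h0
    rw [h.wave_add n s y, h0]
  have hbs : ContDiff ℝ ∞ (U (-(n : ℝ))) := h.flow.contDiff_space h.field _
  have hws := h.contDiff_wave s
  have h1 := hcomp V (U (-(n : ℝ))) (wave U U₀ s) (fun p => p) (U₀ n z) ((M₁ ^ (k + 1)) ^ n)
    (C₄ * (C₀ * θ ^ n) ^ m) hbs hws contDiff_id (by positivity) (by positivity)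
    (fun i h1 h2 y => hb n i h1 h2 y)
    (fun i h1 h2 => by
      have h3 : ‖iteratedFDeriv ℝ i (fun y => wave U U₀ s y - (fun y : V => y) y) (U₀ n z)‖ ≤
        B * ‖U₀ n z‖ ^ 0 := hB i h2 s hs (U₀ n z) hy1
      rw [fun_iteratedFDeriv_sub_apply (ContDiff.at_nat hws i _) (ContDiff.at_nat (f := fun y : V => y) contDiff_fun_id i _),
        pow_zero, mul_one] at h3
      have h4 := norm_iteratedFDeriv_id_le i h1 (U₀ n z)
      have h5 := norm_sub_norm_le (iteratedFDeriv ℝ i (wave U U₀ s) (U₀ n z))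
        (iteratedFDeriv ℝ i (fun y => y) (U₀ n z))
      have h6 := h5.trans h3
      linarith)
    (fun i h1 _ => (norm_iteratedFDeriv_id_le i h1 _).trans (by linarith))
    (fun i h1 => (hfl i h1 s hs (U₀ n z) hy1).trans (by gcongr))
  have h2 := ht n (fun p => U (-(n : ℝ)) (wave U U₀ s p) - U (-(n : ℝ)) p) z _
    ((hbs.comp hws).sub hbs) h1 i hi
  rw [funext hw]
  refine h2.trans ?_
  calc _ = C₂ * C₃ * C₄ * C₀ ^ m * (M₁ ^ (k + 1) * M₂ * θ ^ m) ^ n := by ring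
    _ ≤ _ := by gcongr

/-- The defect of the conjugacy by `U (-n) ∘ U₀ n` decays, with all derivatives, near `E`. -/
theorem exists_defect_bound [ProperSpace V] [CompleteSpace V] (h : WaveData X X₀ U U₀ E P b)
    (k : ℕ) (R : ℝ) :
    ∃ C : ℝ, 0 ≤ C ∧ ∀ (n : ℕ), ∀ z, ‖z‖ ≤ R → ‖z - P z‖ ≤ 2 / b ^ n →
      ‖iteratedFDeriv ℝ k (fun y => X (wave U U₀ n y) - fderiv ℝ (wave U U₀ n) y (X₀ y)) z‖ ≤
        C * (1 / 2) ^ n := by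
  obtain ⟨C₀, θ, hC₀, hθ0, hθ1, hθ⟩ := h.decay R
  obtain ⟨M₁, hM₁, hb⟩ := h.exists_backward_bound (k + 1)
  obtain ⟨C₂, M₂, hC₂, hM₂, ht⟩ := h.exists_transport_bound k
  obtain ⟨m, hm⟩ := exists_pow_le (Λ := M₁ ^ (k + 1) * M₂) (ρ := 1 / 2) hθ1 (by positivity)
    (by norm_num)
  have hX₁ : ContDiff ℝ ∞ (fun x => X x - X₀ x) := h.field.1.sub h.field₀.1
  obtain ⟨C₄, hC₄, hfl⟩ := h.flat.norm_iteratedFDeriv_le hX₁ k m C₀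
  refine ⟨C₂ * 2 ^ k * C₄ * C₀ ^ m, by positivity, fun n z hz hzP => ?_⟩
  have hy := hθ n z hz hzP
  have hy1 : ‖U₀ n z‖ ≤ C₀ := hy.trans (mul_le_of_le_one_right hC₀ (pow_le_one₀ hθ0.le hθ1.le))
  have hbs : ContDiff ℝ ∞ (U (-(n : ℝ))) := h.flow.contDiff_space h.field _
  have hfs : ContDiff ℝ ∞ (U₀ n) := h.flow₀.contDiff_space h.field₀ _
  have hdbs : ContDiff ℝ ∞ (fderiv ℝ (U (-(n : ℝ)))) := hbs.fderiv_right (by simp)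
  -- A flow preserves its own field: differentiate U t (U s x) = U (t + s) x at s = 0.
  have hcomm : ∀ {X : V → V} {U : ℝ → V → V}, IsFlow X U → BddDeriv X → ∀ t x,
      fderiv ℝ (U t) x (X x) = X (U t x) := by
    intro X U hU hX t x
    obtain ⟨K, hK⟩ := hX.lipschitz
    have h1 : HasDerivAt (fun s => U t (U s x)) (fderiv ℝ (U t) x (X x)) 0 := by
      have h2 := hU.hasDerivAt x 0
      rw [(hU x).1] at h2
      have h3 : HasFDerivAt (U t) (fderiv ℝ (U t) x) (U 0 x) := by
        rw [(hU x).1]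
        exact ((hU.contDiff_space hX t).differentiable (by simp) x).hasFDerivAt
      exact h3.comp_hasDerivAt 0 h2
    have h4 : HasDerivAt (fun s => U (t + s) x) (X (U t x)) 0 := by
      have := (hU.hasDerivAt x (t + 0)).comp_const_add t 0
      simpa using this
    refine h1.unique (h4.congr_of_eventuallyEq (Eventually.of_forall fun s => ?_))
    exact (hU.add hK t s x).symm
  have hw : ∀ y, X (wave U U₀ n y) - fderiv ℝ (wave U U₀ n) y (X₀ y) =
      (fun p => fderiv ℝ (U (-(n : ℝ))) p (X p - X₀ p)) (U₀ n y) := fun y => by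
    have h1 : fderiv ℝ (wave U U₀ n) y = fderiv ℝ (U (-(n : ℝ))) (U₀ n y) ∘L fderiv ℝ (U₀ n) y :=
      ((hbs.differentiable (by simp) (U₀ n y)).hasFDerivAt.comp y
        (hfs.differentiable (by simp) y).hasFDerivAt).fderiv
    simp only [h1, ContinuousLinearMap.comp_apply, map_sub, hcomm h.flow h.field,
      hcomm h.flow₀ h.field₀, wave]
  rw [funext hw]
  have h1 : ∀ i ≤ k, ‖iteratedFDeriv ℝ i (fun p => fderiv ℝ (U (-(n : ℝ))) p (X p - X₀ p))
      (U₀ n z)‖ ≤ 2 ^ k * ((M₁ ^ (k + 1)) ^ n * (C₄ * (C₀ * θ ^ n) ^ m)) := fun i hi => by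
    refine (norm_iteratedFDeriv_clm_apply hdbs hX₁ (U₀ n z) (n := i) (mod_cast le_top)).trans ?_
    refine (Finset.sum_le_sum (g := fun l => (i.choose l : ℝ) *
      ((M₁ ^ (k + 1)) ^ n * (C₄ * (C₀ * θ ^ n) ^ m))) fun l hl => ?_).trans ?_
    · have hl' := Finset.mem_range.1 hl
      rw [mul_assoc]
      gcongr
      · rw [norm_iteratedFDeriv_fderiv]
        exact hb n (l + 1) (by lia) (by lia) _
      · exact (hfl (i - l) (by lia) (U₀ n z) hy1).trans (by gcongr)
    · rw [← Finset.sum_mul]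
      gcongr
      norm_cast
      rw [Nat.sum_range_choose]
      gcongr
      norm_num
  refine (ht n _ z _ (hdbs.clm_apply hX₁) h1 k le_rfl).trans ?_
  calc _ = C₂ * 2 ^ k * C₄ * C₀ ^ m * (M₁ ^ (k + 1) * M₂ * θ ^ m) ^ n := by ring
    _ ≤ _ := by gcongr

end WaveData

end Nelson

namespace Nelson

open Set Metric MeasureTheory NNReal

universe u

variable {V : Type u} [NormedAddCommGroup V] [NormedSpace ℝ V]

/-! ### Shrinking cutoffs and the smooth extension of the limit. -/

section Cutoff

variable [HasContDiffBump V]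

/-- A cutoff equal to `1` where `‖Q z‖ ≤ b ^ (-n)` and to `0` where `‖Q z‖ ≥ 2 b ^ (-n)`. -/
noncomputable def cutoff (Q : V →L[ℝ] V) (b : ℝ) (n : ℕ) (z : V) : ℝ :=
  (⟨1, 2, one_pos, one_lt_two⟩ : ContDiffBump (0 : V)) (b ^ n • Q z)

variable {Q : V →L[ℝ] V} {b : ℝ}

theorem contDiff_cutoff (n : ℕ) : ContDiff ℝ ∞ (cutoff Q b n) :=
  (ContDiffBump.contDiff _).comp ((b ^ n • Q).contDiff)

theorem cutoff_eventually_one (n : ℕ) {x : V} (hx : Q x = 0) : ∀ᶠ z in 𝓝 x, cutoff Q b n z = 1 := by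
  have : ∀ᶠ z in 𝓝 x, ‖b ^ n • Q z‖ < 1 :=
    ((b ^ n • Q).continuous.norm).continuousAt.eventually_lt_const (by simp [hx])
  filter_upwards [this] with z hz
  exact ContDiffBump.one_of_mem_closedBall _ (mem_closedBall_zero_iff.2 hz.le)

theorem cutoff_eventually_zero (hb : 1 ≤ b) (n : ℕ) {x : V} (hx : 2 / b ^ n < ‖Q x‖) :
    ∀ᶠ z in 𝓝 x, cutoff Q b n z = 0 := by
  have hb0 : 0 < b ^ n := by positivity
  have : ∀ᶠ z in 𝓝 x, 2 < ‖b ^ n • Q z‖ := by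
    refine ((b ^ n • Q).continuous.norm).continuousAt.eventually_const_lt ?_
    have h2 : ‖b ^ n • Q x‖ = b ^ n * ‖Q x‖ := by rw [norm_smul, Real.norm_of_nonneg hb0.le]
    rw [div_lt_iff₀ hb0, mul_comm] at hx
    exact hx.trans_eq h2.symm
  filter_upwards [this] with z hz
  exact ContDiffBump.zero_of_le_dist _ (by rw [dist_zero_right]; exact hz.le)

theorem exists_cutoff_bound [FiniteDimensional ℝ V] (Q : V →L[ℝ] V) (hb : 1 ≤ b) (k : ℕ) :
    ∃ C : ℝ, 0 ≤ C ∧ ∀ n, ∀ i ≤ k, ∀ z, ‖iteratedFDeriv ℝ i (cutoff Q b n) z‖ ≤ C * (b ^ k) ^ n := by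
  set χ : ContDiffBump (0 : V) := ⟨1, 2, one_pos, one_lt_two⟩ with hχ
  obtain ⟨C, hC1, hC⟩ := (bddDeriv_of_hasCompactSupport χ.contDiff χ.hasCompactSupport).exists_bound k
  set c := 1 + ‖Q‖ with hc
  have hc1 : 1 ≤ c := by simp [hc]
  refine ⟨k.factorial * C * c ^ k, by positivity, fun n i hi z => ?_⟩
  have hbn : 1 ≤ b ^ n := one_le_pow₀ hb
  have h1 : 1 ≤ b ^ n * c := one_le_mul_of_one_le_of_one_le hbn hc1
  have h2 := norm_iteratedFDeriv_comp_le (g := χ) (f := ⇑(b ^ n • Q)) (n := i) (N := ∞)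
    χ.contDiff (b ^ n • Q).contDiff (mod_cast le_top) z (C := C) (D := b ^ n * c)
    (fun l hl => by
      rcases Nat.eq_zero_or_pos l with rfl | hl0
      · rw [norm_iteratedFDeriv_zero, Real.norm_of_nonneg χ.nonneg]
        exact χ.le_one.trans hC1
      · exact hC l hl0 (hl.trans hi) _)
    (fun l hl0 hl => by
      obtain ⟨p, rfl⟩ : ∃ p, l = p + 1 := ⟨l - 1, by lia⟩
      cases p with
      | zero =>
        rw [zero_add, norm_iteratedFDeriv_one, ContinuousLinearMap.fderiv, pow_one]
        refine (ContinuousLinearMap.opNorm_smul_le _ _).trans ?_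
        rw [Real.norm_of_nonneg (by positivity)]
        gcongr
        simp [hc]
      | succ p =>
        rw [ContinuousLinearMap.norm_iteratedFDeriv_add_two, norm_zero]
        positivity)
  refine h2.trans ?_
  calc (i.factorial : ℝ) * C * (b ^ n * c) ^ i ≤ k.factorial * C * (b ^ n * c) ^ k := by gcongr
    _ = _ := by rw [mul_pow, pow_right_comm]; ring

end Cutoff

/-- The displacement of a point from a subspace along a projection. -/
noncomputable def displacement {E : Submodule ℝ V} (P : V →L[ℝ] E) : V →L[ℝ] V :=
  ContinuousLinearMap.id ℝ V - E.subtypeL ∘L P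

theorem displacement_apply {E : Submodule ℝ V} (P : V →L[ℝ] E) (z : V) :
    displacement P z = z - P z := rfl

/-- The increments of the comparison maps, cut off near the subspace. -/
noncomputable def waveTerm [HasContDiffBump V] (U U₀ : ℝ → V → V) {E : Submodule ℝ V}
    (P : V →L[ℝ] E) (b : ℝ) (n : ℕ) (z : V) : V :=
  cutoff (displacement P) b n z • (wave U U₀ (n + 1) z - wave U U₀ n z)

/-- A smooth extension of the limit of the comparison maps. -/
noncomputable def waveExtension [HasContDiffBump V] (U U₀ : ℝ → V → V) {E : Submodule ℝ V}
    (P : V →L[ℝ] E) (b : ℝ) (z : V) : V :=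
  z + ∑' n, waveTerm U U₀ P b n z

namespace WaveData

variable [FiniteDimensional ℝ V] [HasContDiffBump V] [ProperSpace V] [CompleteSpace V]
variable {X X₀ : V → V} {U U₀ : ℝ → V → V} {E : Submodule ℝ V} {P : V →L[ℝ] E} {b : ℝ}

omit [FiniteDimensional ℝ V] [ProperSpace V] in
theorem contDiff_waveTerm (h : WaveData X X₀ U U₀ E P b) (n : ℕ) :
    ContDiff ℝ ∞ (waveTerm U U₀ P b n) :=
  (contDiff_cutoff n).smul ((h.contDiff_wave _).sub (h.contDiff_wave _))

/-- The rate ρ = 1 / (2 b ^ k) for the increments absorbs the factor b ^ (k n) from the cutoff and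
leaves 2⁻ⁿ. Beyond distance 2 / b ^ n the term is locally zero. -/
theorem exists_waveTerm_bound (h : WaveData X X₀ U U₀ E P b) (k : ℕ) (R : ℝ) :
    ∃ v : ℕ → ℝ, Summable v ∧
      ∀ n z, ‖z‖ ≤ R → ‖iteratedFDeriv ℝ k (waveTerm U U₀ P b n) z‖ ≤ v n := by
  have hb := h.one_le
  have hb0 : 0 < b ^ k := by positivity
  obtain ⟨C₁, hC₁, h1⟩ := exists_cutoff_bound (displacement P) hb k
  obtain ⟨C₂, hC₂, h2⟩ := h.exists_increment_bound k R (ρ := 1 / (2 * b ^ k)) (by positivity)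
  refine ⟨fun n => 2 ^ k * C₁ * C₂ * (1 / 2) ^ n,
    (summable_geometric_of_lt_one (by norm_num) (by norm_num)).mul_left _, fun n z hz => ?_⟩
  rcases le_or_gt ‖z - P z‖ (2 / b ^ n) with hzP | hzP
  · have hinc : ContDiff ℝ ∞ fun y => wave U U₀ (n + 1) y - wave U U₀ n y :=
      (h.contDiff_wave _).sub (h.contDiff_wave _)
    refine (norm_iteratedFDeriv_smul_le (contDiff_cutoff n) hinc z (mod_cast le_top)).trans ?_
    refine (Finset.sum_le_sum (g := fun i => (k.choose i : ℝ) *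
      ((C₁ * (b ^ k) ^ n) * (C₂ * (1 / (2 * b ^ k)) ^ n))) fun i hi => ?_).trans ?_
    · have hi' := Finset.mem_range.1 hi
      rw [mul_assoc]
      gcongr
      · exact h1 n i (by lia) z
      · exact h2 n 1 ⟨zero_le_one, le_rfl⟩ z hz hzP (k - i) (by lia)
    · rw [← Finset.sum_mul]
      norm_cast
      rw [Nat.sum_range_choose]
      push_cast
      have : (1 / 2 : ℝ) ^ n = (b ^ k) ^ n * (1 / (2 * b ^ k)) ^ n := by
        rw [← mul_pow]; congr 1; field_simp
      rw [this]
      apply le_of_eq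
      ring
  · have : waveTerm U U₀ P b n =ᶠ[𝓝 z] fun _ => 0 := by
      filter_upwards [cutoff_eventually_zero hb n (Q := displacement P) hzP] with y hy
      rw [waveTerm, hy, zero_smul]
    rw [Filter.EventuallyEq.eq_of_nhds (this.iteratedFDeriv ℝ k), iteratedFDeriv_fun_zero]
    simp only [Pi.zero_apply, norm_zero]
    positivity

theorem contDiff_waveExtension (h : WaveData X X₀ U U₀ E P b) :
    ContDiff ℝ ∞ (waveExtension U U₀ P b) :=
  contDiff_id.add (contDiff_tsum_of_locally_bounded h.contDiff_waveTerm h.exists_waveTerm_bound).1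

/-- Each cutoff is 1 on a neighbourhood of x, so derivatives of the partial sums telescope in all
ambient directions, not only along E. -/
theorem tendsto_iteratedFDeriv_wave_nat (h : WaveData X X₀ U U₀ E P b) (k : ℕ) {x : V}
    (hx : x ∈ E) : Tendsto (fun n : ℕ => iteratedFDeriv ℝ k (wave U U₀ n) x) atTop
      (𝓝 (iteratedFDeriv ℝ k (waveExtension U U₀ P b) x)) := by
  have hs := contDiff_tsum_of_locally_bounded h.contDiff_waveTerm h.exists_waveTerm_bound
  have hQ : displacement P x = 0 := by
    rw [displacement_apply, h.proj ⟨x, hx⟩, sub_self]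
  have h1 : ∀ n, iteratedFDeriv ℝ k (waveTerm U U₀ P b n) x =
      iteratedFDeriv ℝ k (wave U U₀ ((n + 1 : ℕ) : ℝ)) x - iteratedFDeriv ℝ k (wave U U₀ n) x := by
    intro n
    have h2 : waveTerm U U₀ P b n =ᶠ[𝓝 x]
        fun y => wave U U₀ ((n + 1 : ℕ) : ℝ) y - wave U U₀ n y := by
      filter_upwards [cutoff_eventually_one n hQ (b := b)] with y hy
      rw [waveTerm, hy, one_smul, Nat.cast_succ]
    rw [Filter.EventuallyEq.eq_of_nhds (h2.iteratedFDeriv ℝ k)]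
    exact fun_iteratedFDeriv_sub_apply (ContDiff.at_nat (h.contDiff_wave _) k x)
      (ContDiff.at_nat (h.contDiff_wave _) k x)
  have h3 := (hs.2 k x).tendsto_sum_nat
  simp only [h1] at h3
  simp only [Finset.sum_range_sub (fun n : ℕ => iteratedFDeriv ℝ k (wave U U₀ n) x)] at h3
  have h4 := h3.const_add (iteratedFDeriv ℝ k (fun y : V => y) x)
  rw [Nat.cast_zero, h.wave_zero] at h4
  simp only [add_sub_cancel] at h4
  have h5 : iteratedFDeriv ℝ k (waveExtension U U₀ P b) x = iteratedFDeriv ℝ k (fun y : V => y) x +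
      iteratedFDeriv ℝ k (fun z => ∑' n, waveTerm U U₀ P b n z) x :=
    fun_iteratedFDeriv_add_apply (ContDiff.at_nat contDiff_fun_id k x) (ContDiff.at_nat hs.1 k x)
  rwa [h5]

/-- All derivatives of the comparison maps converge at the points of `E`. -/
theorem tendsto_iteratedFDeriv_wave (h : WaveData X X₀ U U₀ E P b) (k : ℕ) {x : V}
    (hx : x ∈ E) : Tendsto (fun t : ℝ => iteratedFDeriv ℝ k (wave U U₀ t) x) atTop
      (𝓝 (iteratedFDeriv ℝ k (waveExtension U U₀ P b) x)) := by
  obtain ⟨C, hC0, hC⟩ := h.exists_increment_bound k ‖x‖ (ρ := 1 / 2) (by norm_num)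
  have h1 : Tendsto (fun t : ℝ => iteratedFDeriv ℝ k (wave U U₀ (⌊t⌋₊ : ℝ)) x) atTop
      (𝓝 (iteratedFDeriv ℝ k (waveExtension U U₀ P b) x)) :=
    (h.tendsto_iteratedFDeriv_wave_nat k hx).comp tendsto_nat_floor_atTop
  have h2 : Tendsto (fun t : ℝ => C * (1 / 2) ^ ⌊t⌋₊) atTop (𝓝 0) := by
    have := (tendsto_pow_atTop_nhds_zero_of_lt_one (r := (1 / 2 : ℝ)) (by norm_num)
      (by norm_num)).comp (tendsto_nat_floor_atTop (α := ℝ))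
    simpa using this.const_mul C
  -- Real times reduce to integers by the increment bound with s = t - ⌊t⌋ in [0, 1].
  have h3 : Tendsto (fun t : ℝ => iteratedFDeriv ℝ k (wave U U₀ t) x -
      iteratedFDeriv ℝ k (wave U U₀ (⌊t⌋₊ : ℝ)) x) atTop (𝓝 0) := by
    refine squeeze_zero_norm' ?_ h2
    filter_upwards [eventually_ge_atTop 0] with t ht
    have h4 := hC ⌊t⌋₊ (t - ⌊t⌋₊) ⟨by linarith [Nat.floor_le ht],
      by linarith [Nat.lt_floor_add_one t]⟩ x le_rfl (by
        rw [h.proj ⟨x, hx⟩, sub_self, norm_zero]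
        have := h.one_le
        positivity) k le_rfl
    rw [add_sub_cancel] at h4
    rwa [fun_iteratedFDeriv_sub_apply (ContDiff.at_nat (h.contDiff_wave _) k x)
      (ContDiff.at_nat (h.contDiff_wave _) k x)] at h4
  simpa using h1.add h3

/-- At 0 each `wave U U₀ n` has the same derivatives as the identity, so the limit does too. -/
theorem waveExtension_sub_vanishes (h : WaveData X X₀ U U₀ E P b) :
    VanishesToInfiniteOrderAt (fun x => waveExtension U U₀ P b x - x) 0 := by
  intro k
  rw [fun_iteratedFDeriv_sub_apply (ContDiff.at_nat h.contDiff_waveExtension k 0)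
    (ContDiff.at_nat (f := fun x : V => x) contDiff_fun_id k 0), sub_eq_zero]
  refine tendsto_nhds_unique (h.tendsto_iteratedFDeriv_wave_nat k E.zero_mem)
    (tendsto_const_nhds.congr fun n => ?_)
  obtain ⟨C, hC0, hC⟩ := h.flow.exists_iteratedFDeriv_wave_sub_bound h.flow₀ h.field h.field₀
    h.zero h.flat n k 1 0
  have h1 : ‖iteratedFDeriv ℝ k (fun y => wave U U₀ n y - (fun y : V => y) y) 0‖ ≤
    C * ‖(0 : V)‖ ^ 1 := hC k le_rfl n ⟨Nat.cast_nonneg n, le_rfl⟩ 0 (by simp)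
  rw [fun_iteratedFDeriv_sub_apply (ContDiff.at_nat (h.contDiff_wave _) k 0)
    (ContDiff.at_nat (f := fun x : V => x) contDiff_fun_id k 0)] at h1
  simp only [norm_zero, pow_one, mul_zero, norm_le_zero_iff, sub_eq_zero] at h1
  exact h1.symm

/-- The extension conjugates the fields to infinite order along `E`. -/
theorem conjugacy_defect_vanishes (h : WaveData X X₀ U U₀ E P b) {x : V} (hx : x ∈ E) :
    VanishesToInfiniteOrderAt
      (fun y => X (waveExtension U U₀ P b y) - fderiv ℝ (waveExtension U U₀ P b) y (X₀ y)) x := by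
  intro k
  set G := waveExtension U U₀ P b with hG
  have hGs : ContDiff ℝ ∞ G := h.contDiff_waveExtension
  have hdiff : ∀ i, Tendsto (fun n : ℕ => ‖iteratedFDeriv ℝ i (fun y => wave U U₀ n y - G y) x‖)
      atTop (𝓝 0) := fun i => by
    have := ((h.tendsto_iteratedFDeriv_wave_nat i hx).sub_const (iteratedFDeriv ℝ i G x)).norm
    rw [sub_self, norm_zero] at this
    refine this.congr fun n => ?_
    rw [fun_iteratedFDeriv_sub_apply (ContDiff.at_nat (h.contDiff_wave _) i x)
      (ContDiff.at_nat hGs i x)]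
  set ε : ℕ → ℝ := fun n => ∑ i ∈ Finset.range (k + 2),
    ‖iteratedFDeriv ℝ i (fun y => wave U U₀ n y - G y) x‖ with hε
  have hε0 : Tendsto ε atTop (𝓝 0) := by
    simpa using tendsto_finsetSum (Finset.range (k + 2)) fun i _ => hdiff i
  have hεle : ∀ n : ℕ, ∀ i ≤ k + 1, ‖iteratedFDeriv ℝ i (fun y => wave U U₀ n y - G y) x‖ ≤ ε n :=
    fun n i hi => Finset.single_le_sum (f := fun i =>
      ‖iteratedFDeriv ℝ i (fun y => wave U U₀ n y - G y) x‖) (fun _ _ => norm_nonneg _)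
      (Finset.mem_range.2 (by lia))
  have hεn : ∀ n, 0 ≤ ε n := fun n => Finset.sum_nonneg fun _ _ => norm_nonneg _
  set B : ℝ := 1 + ∑ i ∈ Finset.range (k + 2), ‖iteratedFDeriv ℝ i G x‖ with hB
  have hB1 : 1 ≤ B := by
    rw [hB]; linarith [Finset.sum_nonneg (s := Finset.range (k + 2))
      fun i _ => norm_nonneg (iteratedFDeriv ℝ i G x)]
  have hGB : ∀ i ≤ k, ‖iteratedFDeriv ℝ i G x‖ ≤ B - 1 := fun i hi => by
    rw [hB, add_sub_cancel_left]
    exact Finset.single_le_sum (f := fun i => ‖iteratedFDeriv ℝ i G x‖) (fun _ _ => norm_nonneg _)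
      (Finset.mem_range.2 (by lia))
  obtain ⟨A, hA1, hA⟩ := h.field.exists_bound (k + 1)
  obtain ⟨C, hC0, hC⟩ := exists_comp_sub_bound V k hB1
  obtain ⟨D, hD0, hD⟩ := h.exists_defect_bound k ‖x‖
  set c : ℝ := ∑ i ∈ Finset.range (k + 1), (k.choose i : ℝ) * ‖iteratedFDeriv ℝ (k - i) X₀ x‖ with hc
  have hlim : Tendsto (fun n : ℕ => C * A * ε n + ε n * c + D * (1 / 2) ^ n) atTop (𝓝 0) := by
    have h1 := tendsto_pow_atTop_nhds_zero_of_lt_one (r := (1 / 2 : ℝ)) (by norm_num) (by norm_num)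
    simpa using ((hε0.const_mul (C * A)).add (hε0.mul_const c)).add (h1.const_mul D)
  have hdG : ContDiff ℝ ∞ (fderiv ℝ G) := hGs.fderiv_right (by simp)
  have hX : ContDiff ℝ ∞ X := h.field.1
  have hX₀ : ContDiff ℝ ∞ X₀ := h.field₀.1
  rw [← norm_le_zero_iff]
  refine ge_of_tendsto hlim ?_
  filter_upwards [hε0.eventually_le_const one_pos] with n hn
  have hW := h.contDiff_wave (n : ℝ)
  have hdW : ContDiff ℝ ∞ (fderiv ℝ (wave U U₀ n)) := hW.fderiv_right (by simp)
  -- The defect of G is that of W_n plus errors controlled by the derivatives of W_n - G at x up to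
  -- order k + 1; all of these tend to 0.
  have e1 : (fun y => X (G y) - fderiv ℝ G y (X₀ y)) = fun y =>
      ((fderiv ℝ (wave U U₀ n) y - fderiv ℝ G y) (X₀ y) - (X (wave U U₀ n y) - X (G y))) +
      (X (wave U U₀ n y) - fderiv ℝ (wave U U₀ n) y (X₀ y)) := by
    ext1 y
    rw [sub_apply]
    abel
  have s1 : ContDiff ℝ ∞ fun y => (fderiv ℝ (wave U U₀ n) y - fderiv ℝ G y) (X₀ y) :=
    (hdW.sub hdG).clm_apply hX₀
  have s2 : ContDiff ℝ ∞ fun y => X (wave U U₀ n y) - X (G y) := (hX.comp hW).sub (hX.comp hGs)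
  have s3 : ContDiff ℝ ∞ fun y => X (wave U U₀ n y) - fderiv ℝ (wave U U₀ n) y (X₀ y) :=
    (hX.comp hW).sub (hdW.clm_apply hX₀)
  rw [e1, fun_iteratedFDeriv_add_apply (ContDiff.at_nat (s1.sub s2) k x) (ContDiff.at_nat s3 k x),
    fun_iteratedFDeriv_sub_apply (ContDiff.at_nat s1 k x) (ContDiff.at_nat s2 k x)]
  have b2 := hC V X (wave U U₀ n) G x A (ε n) hX hW hGs (by linarith) (hεn n)
    (fun i h1 h2 y => hA i h1 h2 y) (fun i h1 h2 => by
      have h3 := hεle n i (by lia)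
      rw [fun_iteratedFDeriv_sub_apply (ContDiff.at_nat hW i x) (ContDiff.at_nat hGs i x)] at h3
      have h4 := norm_sub_norm_le (iteratedFDeriv ℝ i (wave U U₀ n) x) (iteratedFDeriv ℝ i G x)
      have h5 := hGB i h2
      linarith)
    (fun i h1 h2 => (hGB i h2).trans (by linarith)) (fun i hi => hεle n i (by lia)) k le_rfl
  have b1 : ‖iteratedFDeriv ℝ k (fun y => (fderiv ℝ (wave U U₀ n) y - fderiv ℝ G y) (X₀ y)) x‖ ≤
      ε n * c := by
    refine (norm_iteratedFDeriv_clm_apply (hdW.sub hdG) hX₀ x (mod_cast le_top)).trans ?_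
    rw [hc, Finset.mul_sum]
    refine Finset.sum_le_sum fun i hi => ?_
    have hi' := Finset.mem_range.1 hi
    have e2 : (fun y => fderiv ℝ (wave U U₀ n) y - fderiv ℝ G y) =
        fderiv ℝ (fun y => wave U U₀ n y - G y) := by
      ext1 y
      rw [fderiv_fun_sub (hW.differentiable (by simp) y) (hGs.differentiable (by simp) y)]
    have e3 : ‖iteratedFDeriv ℝ i (fun y => fderiv ℝ (wave U U₀ n) y - fderiv ℝ G y) x‖ ≤ ε n := by
      rw [e2, norm_iteratedFDeriv_fderiv]
      exact hεle n (i + 1) (by lia)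
    calc _ ≤ (k.choose i : ℝ) * ε n * ‖iteratedFDeriv ℝ (k - i) X₀ x‖ := by gcongr
      _ = _ := by ring
  have b3 := hD n x le_rfl (by
    rw [h.proj ⟨x, hx⟩, sub_self, norm_zero]
    have := h.one_le
    positivity)
  exact (norm_add_le _ _).trans (add_le_add ((norm_sub_le _ _).trans (by linarith)) b3)

end WaveData

/-! ### Local inversion and the push-forward. -/

/-- A smooth map tangent to the identity at `0` restricts to a diffeomorphism near `0`, and if it
conjugates two fields to infinite order at a point, then so does the push-forward under the
inverse. -/
theorem exists_local_diffeo [CompleteSpace V] {G X X₀ : V → V} (hG : ContDiff ℝ ∞ G)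
    (hX : ContDiff ℝ ∞ X) (hX₀ : ContDiff ℝ ∞ X₀)
    (hG0 : VanishesToInfiniteOrderAt (fun x => G x - x) 0) :
    ∃ Φ : OpenPartialHomeomorph V V, (0 : V) ∈ Φ.source ∧ (∀ x ∈ Φ.source, Φ x = G x) ∧
      ContDiffOn ℝ ∞ Φ.symm Φ.target ∧ ∀ x ∈ Φ.source,
        VanishesToInfiniteOrderAt (fun y => X (G y) - fderiv ℝ G y (X₀ y)) x →
        VanishesToInfiniteOrderAt (fun y => pushforward Φ.symm X y - X₀ y) x := by
  have hd0 : fderiv ℝ G 0 = ContinuousLinearMap.id ℝ V := by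
    have h1 := hG0.fderiv.eq_zero
    rw [fderiv_fun_sub (hG.differentiable (by simp) 0) differentiableAt_fun_id,
      fderiv_fun_id, sub_eq_zero] at h1
    exact h1
  have hdG : ContDiff ℝ ∞ (fderiv ℝ G) := hG.fderiv_right (by simp)
  have hder : HasFDerivAt G ((ContinuousLinearEquiv.refl ℝ V : V ≃L[ℝ] V) : V →L[ℝ] V) 0 := by
    have := (hG.differentiable (by simp) 0).hasFDerivAt
    rwa [hd0] at this
  set e := hG.contDiffAt.toOpenPartialHomeomorph G hder (by simp) with he
  -- Restricting to points where DG is invertible makes the inverse smooth on its whole domain, not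
  -- only at G 0.
  set s : Set V := {y | IsUnit (fderiv ℝ G y)} with hs
  have hso : IsOpen s := Units.isOpen.preimage hdG.continuous
  set Φ := e.restrOpen s hso with hΦ
  have hΦs : Φ.source = e.source ∩ s := e.restrOpen_source s hso
  have hΦG : ∀ x, Φ x = G x := fun x => rfl
  have h0 : (0 : V) ∈ Φ.source := by
    rw [hΦs]
    exact ⟨hG.contDiffAt.mem_toOpenPartialHomeomorph_source hder (by simp), by
      rw [hs, mem_ofPred_eq, hd0]; exact isUnit_one⟩
  have hsymm : ContDiffOn ℝ ∞ Φ.symm Φ.target := fun y hy => by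
    have h1 : Φ.symm y ∈ s := by
      have := Φ.map_target hy
      rw [hΦs] at this
      exact this.2
    obtain ⟨a, ha⟩ := h1
    refine (Φ.contDiffAt_symm (f₀' := ContinuousLinearEquiv.ofUnit a) hy ?_
      hG.contDiffAt).contDiffWithinAt
    have h2 := (hG.differentiable (by simp) (Φ.symm y)).hasFDerivAt
    rw [← ha] at h2
    exact h2
  refine ⟨Φ, h0, fun x _ => rfl, hsymm, fun x hx hflat k => ?_⟩
  set T : V → V →L[ℝ] V := fun y => fderiv ℝ Φ.symm (G y) with hT
  have hTs : ContDiffOn ℝ ∞ T Φ.source :=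
    (hsymm.fderiv_of_isOpen (m := ∞) Φ.open_target (by simp)).comp hG.contDiffOn
      fun y hy => Φ.map_source hy
  have hS : ContDiff ℝ ∞ fun y => X (G y) - fderiv ℝ G y (X₀ y) :=
    (hX.comp hG).sub (hdG.clm_apply hX₀)
  -- The chain rule for Φ.symm ∘ G = id gives T(DG·X₀) = X₀, so the push-forward error is the smooth
  -- operator T applied to the flat defect. The Leibniz rule then gives zero at every order.
  have hpush : ∀ y ∈ Φ.source, pushforward Φ.symm X y - X₀ y =
      T y (X (G y) - fderiv ℝ G y (X₀ y)) := fun y hy => by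
    have h1 : HasFDerivAt Φ.symm (T y) (G y) :=
      ((hsymm.contDiffAt (Φ.open_target.mem_nhds (Φ.map_source hy))).differentiableAt
        (by simp)).hasFDerivAt
    have h2 : HasFDerivAt (fun z => Φ.symm (G z)) (T y ∘L fderiv ℝ G y) y :=
      h1.comp y (hG.differentiable (by simp) y).hasFDerivAt
    have h3 : HasFDerivAt (fun z => Φ.symm (G z)) (ContinuousLinearMap.id ℝ V) y := by
      refine (hasFDerivAt_id y).congr_of_eventuallyEq ?_
      filter_upwards [Φ.open_source.mem_nhds hy] with z hz
      exact Φ.left_inv hz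
    have h4 : T y (fderiv ℝ G y (X₀ y)) = X₀ y := congrArg (· (X₀ y)) (h2.unique h3)
    rw [map_sub, h4]
    rfl
  rw [← iteratedFDerivWithin_of_isOpen k Φ.open_source hx,
    iteratedFDerivWithin_congr (fun y hy => hpush y hy) hx, ← norm_le_zero_iff]
  refine (norm_iteratedFDerivWithin_clm_apply hTs hS.contDiffOn Φ.open_source.uniqueDiffOn hx
    (n := k) (mod_cast le_top)).trans (le_of_eq (Finset.sum_eq_zero fun i _ => ?_))
  rw [iteratedFDerivWithin_of_isOpen (k - i) Φ.open_source hx, hflat (k - i), norm_zero, mul_zero]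

end Nelson

theorem mainTheorem12 (N : ℕ)
    (X X₀ : EuclideanSpace ℝ (Fin N) → EuclideanSpace ℝ (Fin N))
    (hX : ContDiff ℝ ∞ X) (hX₀ : ContDiff ℝ ∞ X₀)
    (hzero : X₀ 0 = 0)
    (hflat : Nelson.VanishesToInfiniteOrderAt (fun x => X x - X₀ x) 0)
    (hlin : ∃ K : Set (EuclideanSpace ℝ (Fin N)), IsCompact K ∧
      ∀ x, x ∉ K → X x = fderiv ℝ X 0 x ∧ X₀ x = fderiv ℝ X 0 x)
    (hhyp : Nelson.IsHyperbolic (fderiv ℝ X 0))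
    (E : Submodule ℝ (EuclideanSpace ℝ (Fin N)))
    (hinv : ∀ x ∈ E, X₀ x ∈ E)
    (hcontr : ∀ x ∈ E, Tendsto (fun t : ℝ => Nelson.flow X₀ t x) atTop (𝓝 0)) :
    -- the flows exist for all times, and their compositions are smooth
    Nelson.IsFlow X (Nelson.flow X) ∧ Nelson.IsFlow X₀ (Nelson.flow X₀) ∧
    (∀ t : ℝ, ContDiff ℝ ∞ (fun y => Nelson.flow X (-t) (Nelson.flow X₀ t y))) ∧
    -- all derivatives, in the ambient space, converge at the points of `E`
    (∀ j : ℕ, ∃ L : EuclideanSpace ℝ (Fin N) →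
          ContinuousMultilinearMap ℝ (fun _ : Fin j => EuclideanSpace ℝ (Fin N))
            (EuclideanSpace ℝ (Fin N)),
        ContinuousOn L E ∧
        ∀ x ∈ E, Tendsto
          (fun t : ℝ => iteratedFDeriv ℝ j
            (fun y => Nelson.flow X (-t) (Nelson.flow X₀ t y)) x) atTop (𝓝 (L x))) ∧
    -- the limit `W_-` on `E` extends to a smooth map `G`
    ∃ G : EuclideanSpace ℝ (Fin N) → EuclideanSpace ℝ (Fin N),
      ContDiff ℝ ∞ G ∧
      (∀ x ∈ E, Tendsto (fun t : ℝ => Nelson.flow X (-t) (Nelson.flow X₀ t x))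
        atTop (𝓝 (G x))) ∧
      Nelson.VanishesToInfiniteOrderAt (fun x => G x - x) 0 ∧
      -- `Φ` is `G` restricted to a neighbourhood of `0`, a diffeomorphism onto its open image
      ∃ Φ : OpenPartialHomeomorph (EuclideanSpace ℝ (Fin N)) (EuclideanSpace ℝ (Fin N)),
        (0 : EuclideanSpace ℝ (Fin N)) ∈ Φ.source ∧
        (∀ x ∈ Φ.source, Φ x = G x) ∧
        ContDiffOn ℝ ∞ Φ.symm Φ.target ∧
        ∀ x ∈ E, x ∈ Φ.source → Nelson.VanishesToInfiniteOrderAt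
          (fun y => Nelson.pushforward Φ.symm X y - X₀ y) x := by
  obtain ⟨K, hK, hKX⟩ := hlin
  set A := fderiv ℝ X 0 with hA
  have hXb : Nelson.BddDeriv X := Nelson.bddDeriv_of_eq_clm hX A hK fun x hx => (hKX x hx).1
  have hX₀b : Nelson.BddDeriv X₀ := Nelson.bddDeriv_of_eq_clm hX₀ A hK fun x hx => (hKX x hx).2
  obtain ⟨L, hL⟩ := hXb.lipschitz
  obtain ⟨L₀, hL₀⟩ := hX₀b.lipschitz
  have hU : Nelson.IsFlow X (Nelson.flow X) := Nelson.isFlow_flow (hX.of_le (by simp)) hL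
  have hU₀ : Nelson.IsFlow X₀ (Nelson.flow X₀) := Nelson.isFlow_flow (hX₀.of_le (by simp)) hL₀
  have hA₀ : fderiv ℝ X₀ 0 = A := by
    have h1 := hflat.fderiv.eq_zero
    rw [fderiv_fun_sub (hX.differentiable (by simp) 0) (hX₀.differentiable (by simp) 0),
      sub_eq_zero] at h1
    exact h1.symm
  set P := E.orthogonalProjectionOnto with hP
  have hproj : ∀ x : E, P x = x := fun x => Submodule.orthogonalProjectionOnto_mem_subspace_eq_self x
  have hE : IsClosed (E : Set (EuclideanSpace ℝ (Fin N))) := E.closed_of_finiteDimensional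
  obtain ⟨b, hb1, hb⟩ := Nelson.exists_decay_near P hU₀ hX₀b
    (hU₀.exists_exponential_decay hX₀b hzero hA₀ hK (fun x hx => (hKX x hx).2) hE
      (fun t x hx => hU₀.mem_of_invariant hX₀b P hproj hinv t hx) hcontr)
  have h : Nelson.WaveData X X₀ (Nelson.flow X) (Nelson.flow X₀) E P b :=
    { flow := hU
      flow₀ := hU₀
      field := hXb
      field₀ := hX₀b
      zero := hzero
      flat := hflat
      backward := hU.bddDeriv hX A hK (fun x hx => (hKX x hx).1) (-1)
      forward := hU₀.bddDeriv hX₀ A hK (fun x hx => (hKX x hx).2) 1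
      proj := hproj
      one_le := hb1
      decay := hb }
  have hG := h.contDiff_waveExtension
  obtain ⟨Φ, hΦ0, hΦG, hΦs, hΦ⟩ := Nelson.exists_local_diffeo hG hX hX₀ h.waveExtension_sub_vanishes
  -- The limit of the j-th derivatives is the j-th derivative of the smooth extension, whence its
  -- continuity along E.
  refine ⟨hU, hU₀, h.contDiff_wave, fun j => ⟨_,
    (hG.continuous_iteratedFDeriv (m := j) (mod_cast le_top)).continuousOn,
    fun x hx => h.tendsto_iteratedFDeriv_wave j hx⟩, _, hG, fun x hx => ?_,
    h.waveExtension_sub_vanishes, Φ, hΦ0, hΦG, hΦs,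
    fun x hxE hxΦ => hΦ x hxΦ (h.conjugacy_defect_vanishes hxE)⟩
  have h1 := (h.tendsto_iteratedFDeriv_wave 0 hx)
  simp only [iteratedFDeriv_zero_eq_comp] at h1
  simpa using! ((continuousMultilinearCurryFin0 ℝ (EuclideanSpace ℝ (Fin N))
    (EuclideanSpace ℝ (Fin N))).continuous.tendsto _).comp h1
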